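/- Let $K$ be a field with $\operatorname{char} K\neq 2$ and let $a,b,c\in K^\times$. For signs $\varepsilon_1,\varepsilon_2,\varepsilon_3\in\{1,-1\}$ let $\sigma_1,\sigma_2$ be the $K$-automorphisms of the rational function field $K(x_1,x_2,x_3)$ given by $$\sigma_1:\ x_1\mapsto \varepsilon_1x_1,\quad x_2\mapsto \frac{b}{x_2},\quad x_3\mapsto\frac{c}{x_3};\qquad \sigma_2:\ x_1\mapsto \frac{a}{x_1},\quad x_2\mapsto \varepsilon_2x_2,\quad x_3\mapsto\frac{\varepsilon_3c}{x_3}.$$ The Noether problem of the group $(3,3,1,1)$ asks whether the invariant field $N=K(x_1,x_2,x_3)^{\langle\sigma_1,\sigma_2\rangle}$ is rational (purely transcendental) over $K$; it is called affirmative if this is so and negative if not. For $a',b',c'\in K^\times$, the problem $R(a',b',c')$ is the same question for the invariant field $K(x_1,x_2,x_3)^{\langle\sigma\rangle}$ of the $K$-automorphism $$\sigma:\ x_1\mapsto -x_1,\quad x_2\mapsto\frac{a'}{x_2},\quad x_3\mapsto\frac{-b'x_1^2+c'}{x_3}.$$ We say that the Noether problem is reduced to $R(a',b',c')$ if $N$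 is isomorphic over $K$ to the invariant field of $R(a',b',c')$; in particular the two problems then have the same answer. Write $K^{\times2}$ for the group of squares in $K^\times$. Then the following hold. 1. If $\varepsilon_1=\varepsilon_2=\varepsilon_3=1$, the Noether problem is reduced to $R(a,b,c)$. 2. If $\varepsilon_1=\varepsilon_2=-1$, $\varepsilon_3=1$, it is reduced to $R(a,b,c)$; if $\varepsilon_1=\varepsilon_3=-1$, $\varepsilon_2=1$, it is reduced to $R(-a,b,c)$; if $\varepsilon_2=\varepsilon_3=-1$, $\varepsilon_1=1$, it is reduced to $R(a,-b,-c)$. 3. If exactly one of $\varepsilon_1,\varepsilon_2,\varepsilon_3$ equals $-1$, the Noether problem is affirmative. 4. Suppose $\varepsilon_1=\varepsilon_2=\varepsilon_3=-1$. - (i) If $a$ or $-a$ lies in $K^{\times2}$, the Noether problem is reduced to $R(b,-1,c)$; if $b$ or $-b$ lies in $K^{\times2}$, it is reduced to $R(a,-1,-c)$; if $c$ or $-c$ lies in $K^{\times2}$, it is reduced to $R(a,-1,b)$. - (ii) If $ab\in K^{\times2}$, it is reduced to $R(a,c,-ac)$; if $-ac\in K^{\times2}$, it is reduced to $R(-a,b,ab)$;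 if $bc\in K^{\times2}$, it is reduced to $R(-b,a,ab)$. - (iii) If none of $a,-a,b,-b,c,-c,ab,-ac,bc$ lies in $K^{\times2}$, the Noether problem is negative. -/

import Mathlib

noncomputable section

namespace MonomialNoether

/-- The rational function field `K(x₁, x₂, x₃)`; the indices in `Fin 3` are `0, 1, 2`. -/
abbrev RatFun3 (K : Type*) [Field K] : Type _ := FractionRing (MvPolynomial (Fin 3) K)

variable {K : Type*} [Field K]

/-- The variable `x_{i+1}` of `K(x₁, x₂, x₃)`. -/
def x (i : Fin 3) : RatFun3 K :=
  algebraMap (MvPolynomial (Fin 3) K) (RatFun3 K) (MvPolynomial.X i)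

/-- The element `a ∈ K` as a constant of `K(x₁, x₂, x₃)`. -/
def const (a : K) : RatFun3 K := algebraMap K (RatFun3 K) a

/-- The sign `ε = ±1` as a constant of `K(x₁, x₂, x₃)`. -/
def sgn (K : Type*) [Field K] (ε : ℤˣ) : RatFun3 K := const ((ε : ℤ) : K)

lemma x_ne_zero (i : Fin 3) : (x i : RatFun3 K) ≠ 0 := by
  simp [x]

lemma const_ne_zero (a : Kˣ) : (const (a : K) : RatFun3 K) ≠ 0 := by
  simp [const]

lemma sgn_mul_self (ε : ℤˣ) : sgn K ε * sgn K ε = 1 := by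
  rcases Int.units_eq_one_or ε with rfl | rfl <;> simp [sgn, const]

/-- An intermediate field that contains `x₁, x₂, x₃` is everything. -/
lemma eq_top_of_x_mem (E : IntermediateField K (RatFun3 K)) (h : ∀ i, x i ∈ E) : E = ⊤ := by
  have hp : ∀ p : MvPolynomial (Fin 3) K,
      algebraMap (MvPolynomial (Fin 3) K) (RatFun3 K) p ∈ E := by
    intro p
    induction p using MvPolynomial.induction_on with
    | C a =>
      have := E.algebraMap_mem a
      rwa [IsScalarTower.algebraMap_apply K (MvPolynomial (Fin 3) K) (RatFun3 K)] at this
    | add p q hp hq => rw [map_add]; exact E.add_mem hp hq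
    | mul_X p i hp => rw [map_mul]; exact E.mul_mem hp (h i)
  rw [eq_top_iff]
  intro z _
  obtain ⟨p, q, _, rfl⟩ := IsFractionRing.div_surjective (A := MvPolynomial (Fin 3) K) z
  exact E.div_mem (hp p) (hp q)

/-- Three elements that generate `K(x₁, x₂, x₃)` are algebraically independent. -/
lemma algebraicIndependent_of_adjoin_eq_top (g : Fin 3 → RatFun3 K)
    (hg : IntermediateField.adjoin K (Set.range g) = ⊤) : AlgebraicIndependent K g := by
  have halg : Algebra.IsAlgebraic (Algebra.adjoin K (Set.range g)) (RatFun3 K) := by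
    refine ⟨fun z => ?_⟩
    have hz : z ∈ IntermediateField.adjoin K (Set.range g) := hg ▸ IntermediateField.mem_top
    obtain ⟨r, hr, s, hs, rfl⟩ := (IntermediateField.mem_adjoin_iff_div).1 hz
    exact (isAlgebraic_algebraMap (⟨r, hr⟩ : Algebra.adjoin K (Set.range g))).mul
      (isAlgebraic_algebraMap (⟨s, hs⟩ : Algebra.adjoin K (Set.range g))).inv
  have htr : 3 ≤ Algebra.trdeg K (RatFun3 K) := by
    have hX : AlgebraicIndependent K (x : Fin 3 → RatFun3 K) :=
      (MvPolynomial.algebraicIndependent_X (Fin 3) K).map'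
        (f := IsScalarTower.toAlgHom K (MvPolynomial (Fin 3) K) (RatFun3 K))
        (IsFractionRing.injective _ _)
    simpa using hX.lift_cardinalMk_le_trdeg
  exact (Algebra.IsAlgebraic.isTranscendenceBasis_of_lift_le_trdeg_of_finite K g
    (by simpa using htr)).1

/-- The `K`-automorphism of `K(x₁, x₂, x₃)` that maps `x_{i+1}` to `g i`, for three elements `g`
that generate `K(x₁, x₂, x₃)`. -/
def substAut (g : Fin 3 → RatFun3 K) (hg : IntermediateField.adjoin K (Set.range g) = ⊤) :
    RatFun3 K ≃ₐ[K] RatFun3 K :=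
  (algebraicIndependent_of_adjoin_eq_top g hg).aevalEquivField.trans
    ((IntermediateField.equivOfEq hg).trans IntermediateField.topEquiv)

lemma substAut_x (g : Fin 3 → RatFun3 K) (hg : IntermediateField.adjoin K (Set.range g) = ⊤)
    (i : Fin 3) : substAut g hg (x i) = g i := by
  change (((algebraicIndependent_of_adjoin_eq_top g hg).aevalEquivField
    (algebraMap _ _ (MvPolynomial.X i)) : _) : RatFun3 K) = g i
  rw [AlgebraicIndependent.aevalEquivField_algebraMap_apply_coe, MvPolynomial.aeval_X]

/-- Generation criterion: the `x_i` lie in the field generated by the `g i`. -/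
lemma adjoin_range_eq_top (g : Fin 3 → RatFun3 K)
    (h : ∀ E : IntermediateField K (RatFun3 K), (∀ i, g i ∈ E) → ∀ i, x i ∈ E) :
    IntermediateField.adjoin K (Set.range g) = ⊤ :=
  eq_top_of_x_mem _ (h _ fun i => IntermediateField.subset_adjoin K _ ⟨i, rfl⟩)

lemma const_mem (E : IntermediateField K (RatFun3 K)) (a : K) : const a ∈ E := E.algebraMap_mem a

lemma sgn_mem (E : IntermediateField K (RatFun3 K)) (ε : ℤˣ) : sgn K ε ∈ E := const_mem E _

lemma mem_of_mul_mem (E : IntermediateField K (RatFun3 K)) {u z : RatFun3 K} (hu : u ∈ E)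
    (hu0 : u ≠ 0) (h : u * z ∈ E) : z ∈ E := by
  have := E.div_mem h hu
  rwa [mul_div_cancel_left₀ _ hu0] at this

lemma mem_of_div_mem (E : IntermediateField K (RatFun3 K)) {u z : RatFun3 K} (hu : u ∈ E)
    (hu0 : u ≠ 0) (h : u / z ∈ E) : z ∈ E := by
  have := E.div_mem hu h
  rwa [div_div_cancel₀ hu0] at this

lemma sgn_ne_zero (ε : ℤˣ) : sgn K ε ≠ 0 := by
  intro h
  have := sgn_mul_self (K := K) ε
  simp [h] at this

/-- `σ₁ : x₁ ↦ ε₁ x₁, x₂ ↦ b / x₂, x₃ ↦ c / x₃`. -/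
def sigma₁ (ε₁ : ℤˣ) (b c : Kˣ) : RatFun3 K ≃ₐ[K] RatFun3 K :=
  substAut ![sgn K ε₁ * x 0, const (b : K) / x 1, const (c : K) / x 2] <|
    adjoin_range_eq_top _ fun E h => by
      have h0 : sgn K ε₁ * x 0 ∈ E := h 0
      have h1 : const (b : K) / x 1 ∈ E := h 1
      have h2 : const (c : K) / x 2 ∈ E := h 2
      rw [Fin.forall_fin_succ, Fin.forall_fin_two]
      exact ⟨mem_of_mul_mem E (sgn_mem E _) (sgn_ne_zero _) h0,
        mem_of_div_mem E (const_mem E _) (const_ne_zero _) h1,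
        mem_of_div_mem E (const_mem E _) (const_ne_zero _) h2⟩

/-- `σ₂ : x₁ ↦ a / x₁, x₂ ↦ ε₂ x₂, x₃ ↦ ε₃ c / x₃`. -/
def sigma₂ (ε₂ ε₃ : ℤˣ) (a c : Kˣ) : RatFun3 K ≃ₐ[K] RatFun3 K :=
  substAut ![const (a : K) / x 0, sgn K ε₂ * x 1, sgn K ε₃ * const (c : K) / x 2] <|
    adjoin_range_eq_top _ fun E h => by
      have h0 : const (a : K) / x 0 ∈ E := h 0
      have h1 : sgn K ε₂ * x 1 ∈ E := h 1
      have h2 : sgn K ε₃ * const (c : K) / x 2 ∈ E := h 2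
      rw [Fin.forall_fin_succ, Fin.forall_fin_two]
      exact ⟨mem_of_div_mem E (const_mem E _) (const_ne_zero _) h0,
        mem_of_mul_mem E (sgn_mem E _) (sgn_ne_zero _) h1,
        mem_of_div_mem E (E.mul_mem (sgn_mem E _) (const_mem E _))
          (mul_ne_zero (sgn_ne_zero _) (const_ne_zero _)) h2⟩

/-- The field `K(x₁, x₂, x₃)^⟨σ₁, σ₂⟩` of the Noether problem of the group (3,3,1,1) with signs
`ε₁, ε₂, ε₃` and coefficients `a, b, c`. -/
def noether3311 (ε₁ ε₂ ε₃ : ℤˣ) (a b c : Kˣ) : IntermediateField K (RatFun3 K) :=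
  IntermediateField.fixedField (Subgroup.closure {sigma₁ ε₁ b c, sigma₂ ε₂ ε₃ a c})

lemma quad_ne_zero (b c : Kˣ) :
    (-const (b : K) * x 0 ^ 2 + const (c : K) : RatFun3 K) ≠ 0 := by
  intro h
  have hp : (-MvPolynomial.C (b : K) * MvPolynomial.X 0 ^ 2 + MvPolynomial.C (c : K) :
      MvPolynomial (Fin 3) K) = 0 := by
    apply IsFractionRing.injective (MvPolynomial (Fin 3) K) (RatFun3 K)
    rw [map_zero, ← h, map_add, map_mul, map_neg, map_pow, const, const,
      IsScalarTower.algebraMap_apply K (MvPolynomial (Fin 3) K) (RatFun3 K),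
      IsScalarTower.algebraMap_apply K (MvPolynomial (Fin 3) K) (RatFun3 K)]
    rfl
  have := congrArg (MvPolynomial.eval 0) hp
  simp at this

/-- `σ : x₁ ↦ -x₁, x₂ ↦ a / x₂, x₃ ↦ (-b x₁² + c) / x₃`. -/
def sigmaR (a b c : Kˣ) : RatFun3 K ≃ₐ[K] RatFun3 K :=
  substAut ![-x 0, const (a : K) / x 1, (-const (b : K) * x 0 ^ 2 + const (c : K)) / x 2] <|
    adjoin_range_eq_top _ fun E h => by
      have h0 : -x 0 ∈ E := h 0
      have h1 : const (a : K) / x 1 ∈ E := h 1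
      have h2 : (-const (b : K) * x 0 ^ 2 + const (c : K)) / x 2 ∈ E := h 2
      rw [neg_mem_iff] at h0
      rw [Fin.forall_fin_succ, Fin.forall_fin_two]
      exact ⟨h0, mem_of_div_mem E (const_mem E _) (const_ne_zero _) h1,
        mem_of_div_mem E (E.add_mem (E.mul_mem (E.neg_mem (const_mem E _)) (E.pow_mem h0 2))
          (const_mem E _)) (quad_ne_zero b c) h2⟩

/-- The field `K(x₁, x₂, x₃)^⟨σ⟩` of the problem `R(a, b, c)`. -/
def problemR (a b c : Kˣ) : IntermediateField K (RatFun3 K) :=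
  IntermediateField.fixedField (Subgroup.zpowers (sigmaR a b c))

/-- The Noether problem with invariant field `E` is reduced to the one with invariant field `E'`:
the two invariant fields are isomorphic over `K`. In particular one of them is rational over `K`
if and only if the other is. -/
def ReducesTo (E E' : IntermediateField K (RatFun3 K)) : Prop := Nonempty (E ≃ₐ[K] E')

/-- The Noether problem with invariant field `E` is affirmative: `E` is a rational (that is,
purely transcendental) extension of `K`. -/
def Affirmative (E : IntermediateField K (RatFun3 K)) : Prop :=
  ∃ n : ℕ, Nonempty (E ≃ₐ[K] FractionRing (MvPolynomial (Fin n) K))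

/-- Problems that reduce to each other have the same answer. -/
lemma ReducesTo.affirmative_iff {E E' : IntermediateField K (RatFun3 K)} (h : ReducesTo E E') :
    Affirmative E ↔ Affirmative E' := by
  obtain ⟨e⟩ := h
  exact ⟨fun ⟨n, ⟨f⟩⟩ => ⟨n, ⟨e.symm.trans f⟩⟩, fun ⟨n, ⟨f⟩⟩ => ⟨n, ⟨e.trans f⟩⟩⟩

lemma sigma₁_x (ε₁ : ℤˣ) (b c : Kˣ) :
    sigma₁ ε₁ b c (x 0) = sgn K ε₁ * x 0 ∧ sigma₁ ε₁ b c (x 1) = const (b : K) / x 1 ∧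
      sigma₁ ε₁ b c (x 2) = const (c : K) / x 2 :=
  ⟨substAut_x _ _ 0, substAut_x _ _ 1, substAut_x _ _ 2⟩

lemma sigma₂_x (ε₂ ε₃ : ℤˣ) (a c : Kˣ) :
    sigma₂ ε₂ ε₃ a c (x 0) = const (a : K) / x 0 ∧
      sigma₂ ε₂ ε₃ a c (x 1) = sgn K ε₂ * x 1 ∧
      sigma₂ ε₂ ε₃ a c (x 2) = sgn K ε₃ * const (c : K) / x 2 :=
  ⟨substAut_x _ _ 0, substAut_x _ _ 1, substAut_x _ _ 2⟩

lemma sigmaR_x (a b c : Kˣ) :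
    sigmaR a b c (x 0) = -x 0 ∧ sigmaR a b c (x 1) = const (a : K) / x 1 ∧
      sigmaR a b c (x 2) = (-const (b : K) * x 0 ^ 2 + const (c : K)) / x 2 :=
  ⟨substAut_x _ _ 0, substAut_x _ _ 1, substAut_x _ _ 2⟩

end MonomialNoether

end

noncomputable section

namespace MonomialNoether

/-- Every element of a quadratic extension `E(w)`, `w² ∈ E`, has the form `A + B w`. -/
lemma exists_add_mul_of_sq_mem {F Ω : Type*} [Field F] [Field Ω] [Algebra F Ω]
    (E : IntermediateField F Ω) {w : Ω} (hw : w ^ 2 ∈ E)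
    {z : Ω} (hz : ∀ E' : IntermediateField F Ω, E ≤ E' → w ∈ E' → z ∈ E') :
    ∃ A ∈ E, ∃ B ∈ E, z = A + B * w := by
  by_cases hwE : w ∈ E
  · exact ⟨z, hz E le_rfl hwE, 0, E.zero_mem, by ring⟩
  let E' : IntermediateField F Ω :=
    { carrier := {z | ∃ A ∈ E, ∃ B ∈ E, z = A + B * w}
      mul_mem' := by
        rintro _ _ ⟨A, hA, B, hB, rfl⟩ ⟨A', hA', B', hB', rfl⟩
        exact ⟨A * A' + B * B' * w ^ 2,
          E.add_mem (E.mul_mem hA hA') (E.mul_mem (E.mul_mem hB hB') hw), A * B' + B * A',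
          E.add_mem (E.mul_mem hA hB') (E.mul_mem hB hA'), by ring⟩
      one_mem' := ⟨1, E.one_mem, 0, E.zero_mem, by ring⟩
      add_mem' := by
        rintro _ _ ⟨A, hA, B, hB, rfl⟩ ⟨A', hA', B', hB', rfl⟩
        exact ⟨A + A', E.add_mem hA hA', B + B', E.add_mem hB hB', by ring⟩
      zero_mem' := ⟨0, E.zero_mem, 0, E.zero_mem, by ring⟩
      algebraMap_mem' := fun r => ⟨algebraMap F Ω r, E.algebraMap_mem r, 0, E.zero_mem, by ring⟩
      inv_mem' := by
        rintro _ ⟨A, hA, B, hB, rfl⟩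
        by_cases hB0 : B = 0
        · subst hB0
          exact ⟨A⁻¹, E.inv_mem hA, 0, E.zero_mem, by simp⟩
        have h1 : A + B * w ≠ 0 := fun h => hwE <| by
          have : w = -A / B := by field_simp; linear_combination h
          exact this ▸ E.div_mem (E.neg_mem hA) hB
        have h2 : A - B * w ≠ 0 := fun h => hwE <| by
          have : w = A / B := by field_simp; linear_combination -h
          exact this ▸ E.div_mem hA hB
        have hn : A ^ 2 - B ^ 2 * w ^ 2 ∈ E :=
          E.sub_mem (pow_mem hA 2) (E.mul_mem (pow_mem hB 2) hw)
        have hn0 : A ^ 2 - B ^ 2 * w ^ 2 ≠ 0 := by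
          have : A ^ 2 - B ^ 2 * w ^ 2 = (A + B * w) * (A - B * w) := by ring
          rw [this]; exact mul_ne_zero h1 h2
        refine ⟨A / (A ^ 2 - B ^ 2 * w ^ 2), E.div_mem hA hn, -B / (A ^ 2 - B ^ 2 * w ^ 2),
          E.div_mem (E.neg_mem hB) hn, ?_⟩
        refine inv_eq_of_mul_eq_one_right ?_
        field_simp
        ring }
  exact hz E' (fun A hA => ⟨A, hA, 0, E.zero_mem, by ring⟩) ⟨0, E.zero_mem, 1, E.one_mem, by ring⟩

lemma mem_of_fixed_of_sq_mem {F Ω : Type*} [Field F] [Field Ω] [Algebra F Ω] (h2 : (2 : Ω) ≠ 0)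
    (E : IntermediateField F Ω) {w : Ω} (hw : w ^ 2 ∈ E) (hw0 : w ≠ 0)
    (g : Ω ≃ₐ[F] Ω) (hgE : ∀ z ∈ E, g z = z) (hgw : g w = -w) {z : Ω} (hz : g z = z)
    (hzE : ∀ E' : IntermediateField F Ω, E ≤ E' → w ∈ E' → z ∈ E') : z ∈ E := by
  obtain ⟨A, hA, B, hB, rfl⟩ := exists_add_mul_of_sq_mem E hw hzE
  rw [map_add, map_mul, hgE A hA, hgE B hB, hgw] at hz
  have : 2 * (B * w) = 0 := by linear_combination -hz
  have hB0 : B = 0 := by simpa [h2, hw0] using this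
  simpa [hB0] using hA

variable {K : Type*} [Field K]

lemma ringHom_ext {R : Type*} [Semiring R] {f g : RatFun3 K →+* R}
    (hc : ∀ a, f (const a) = g (const a)) (hx : ∀ i, f (x i) = g (x i)) : f = g :=
  IsLocalization.ringHom_ext (nonZeroDivisors (MvPolynomial (Fin 3) K)) <|
    MvPolynomial.ringHom_ext (fun a => hc a) hx

lemma algHom_ext {A : Type*} [Semiring A] [Algebra K A] {f g : RatFun3 K →ₐ[K] A}
    (hx : ∀ i, f (x i) = g (x i)) : f = g :=
  AlgHom.coe_ringHom_injective <| ringHom_ext (fun a => (f.commutes a).trans (g.commutes a).symm) hx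

lemma map_const {F : Type*} [FunLike F (RatFun3 K) (RatFun3 K)]
    [AlgHomClass F K (RatFun3 K) (RatFun3 K)] (f : F) (a : K) : f (const a) = const a :=
  AlgHomClass.commutes f a

lemma mem_fixedField_closure_pair {Ω : Type*} [Field Ω] [Algebra K Ω] (g₁ g₂ : Ω ≃ₐ[K] Ω) (z : Ω) :
    z ∈ IntermediateField.fixedField (Subgroup.closure {g₁, g₂}) ↔ g₁ z = z ∧ g₂ z = z := by
  rw [IntermediateField.mem_fixedField_iff]
  refine ⟨fun h => ⟨h _ (Subgroup.subset_closure (by simp)), h _ (Subgroup.subset_closure (by simp))⟩,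
    fun ⟨h₁, h₂⟩ f hf => ?_⟩
  have : Subgroup.closure {g₁, g₂} ≤ MulAction.stabilizer (Ω ≃ₐ[K] Ω) z := by
    rw [Subgroup.closure_le]
    rintro _ (rfl | rfl)
    · exact h₁
    · exact h₂
  exact this hf

lemma mem_noether3311 {ε₁ ε₂ ε₃ : ℤˣ} {a b c : Kˣ} {z : RatFun3 K} :
    z ∈ noether3311 ε₁ ε₂ ε₃ a b c ↔ sigma₁ ε₁ b c z = z ∧ sigma₂ ε₂ ε₃ a c z = z :=
  mem_fixedField_closure_pair _ _ z

lemma mem_problemR {a b c : Kˣ} {z : RatFun3 K} : z ∈ problemR a b c ↔ sigmaR a b c z = z := by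
  have := mem_fixedField_closure_pair (sigmaR a b c) (sigmaR a b c) z
  rw [Set.pair_eq_singleton, ← Subgroup.zpowers_eq_closure, and_self] at this
  exact this

lemma ReducesTo.symm {E E' : IntermediateField K (RatFun3 K)} (h : ReducesTo E E') :
    ReducesTo E' E := ⟨h.some.symm⟩

lemma ReducesTo.trans {E E' E'' : IntermediateField K (RatFun3 K)} (h : ReducesTo E E')
    (h' : ReducesTo E' E'') : ReducesTo E E'' := ⟨h.some.trans h'.some⟩

lemma reducesTo_of_map_eq {E E' : IntermediateField K (RatFun3 K)}
    (j : RatFun3 K →ₐ[K] RatFun3 K) (h : ∀ z, z ∈ E' ↔ ∃ z' ∈ E, j z' = z) : ReducesTo E E' :=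
  ⟨(IntermediateField.equivMap E j).trans (IntermediateField.equivOfEq (by
    ext z
    rw [h z]
    exact Iff.rfl))⟩

lemma x_algebraicIndependent : AlgebraicIndependent K (x : Fin 3 → RatFun3 K) :=
  (MvPolynomial.algebraicIndependent_X (Fin 3) K).map'
    (f := IsScalarTower.toAlgHom K (MvPolynomial (Fin 3) K) (RatFun3 K))
    (IsFractionRing.injective _ _)

/-- Three elements such that `K(x₁, x₂, x₃)` is generated over `K(g)` by square roots are
algebraically independent. -/
lemma algebraicIndependent_of_sq_mem (g : Fin 3 → RatFun3 K) (W : Set (RatFun3 K))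
    (hW : ∀ w ∈ W, w ^ 2 ∈ IntermediateField.adjoin K (Set.range g))
    (hgen : ∀ E : IntermediateField K (RatFun3 K), (∀ i, g i ∈ E) → (∀ w ∈ W, w ∈ E) →
      ∀ i, x i ∈ E) : AlgebraicIndependent K g := by
  set E := IntermediateField.adjoin K (Set.range g) with hE
  have hgE : ∀ i, g i ∈ E := fun i => IntermediateField.subset_adjoin K _ ⟨i, rfl⟩
  have htop : IntermediateField.adjoin E W = ⊤ := by
    have h1 : (IntermediateField.adjoin E W).restrictScalars K = ⊤ := by
      refine eq_top_of_x_mem _ (hgen _ (fun i => ?_) fun w hw => ?_)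
      · exact (IntermediateField.adjoin E W).algebraMap_mem ⟨g i, hgE i⟩
      · exact IntermediateField.subset_adjoin E W hw
    rw [eq_top_iff]
    intro z _
    have : z ∈ (IntermediateField.adjoin E W).restrictScalars K := h1 ▸ IntermediateField.mem_top
    exact this
  have halgE : Algebra.IsAlgebraic E (RatFun3 K) := by
    have h1 : Algebra.IsAlgebraic E (IntermediateField.adjoin E W) := by
      refine IntermediateField.isAlgebraic_adjoin fun w hw => ?_
      exact IsIntegral.of_pow (n := 2) two_pos
        (isIntegral_algebraMap (R := E) (A := RatFun3 K) (x := ⟨w ^ 2, hW w hw⟩))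
    rw [htop] at h1
    exact IntermediateField.topEquiv.isAlgebraic_iff.1 h1
  have halg : Algebra.IsAlgebraic (Algebra.adjoin K (Set.range g)) (RatFun3 K) := by
    open scoped IntermediateField.algebraAdjoinAdjoin in
    exact Algebra.IsAlgebraic.trans (Algebra.adjoin K (Set.range g)) E (RatFun3 K)
  have htr : 3 ≤ Algebra.trdeg K (RatFun3 K) := by
    simpa using (x_algebraicIndependent (K := K)).lift_cardinalMk_le_trdeg
  exact (Algebra.IsAlgebraic.isTranscendenceBasis_of_lift_le_trdeg_of_finite K g
    (by simpa using htr)).1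

/-- The embedding of `K(x₁, x₂, x₃)` into itself given by algebraically independent elements. -/
def substHom (y : Fin 3 → RatFun3 K) (hy : AlgebraicIndependent K y) : RatFun3 K →ₐ[K] RatFun3 K :=
  (IntermediateField.val _).comp hy.aevalEquivField.toAlgHom

lemma substHom_x (y : Fin 3 → RatFun3 K) (hy : AlgebraicIndependent K y) (i : Fin 3) :
    substHom y hy (x i) = y i := by
  change (((hy.aevalEquivField (algebraMap _ _ (MvPolynomial.X i)) : _) : RatFun3 K)) = y i
  rw [AlgebraicIndependent.aevalEquivField_algebraMap_apply_coe, MvPolynomial.aeval_X]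

lemma mem_range_substHom (y : Fin 3 → RatFun3 K) (hy : AlgebraicIndependent K y) {z : RatFun3 K}
    (hz : z ∈ IntermediateField.adjoin K (Set.range y)) : ∃ z', substHom y hy z' = z :=
  ⟨hy.aevalEquivField.symm ⟨z, hz⟩, by simp [substHom]⟩

lemma mem_of_forall_mem (y : Fin 3 → RatFun3 K) {z : RatFun3 K}
    (h : ∀ E : IntermediateField K (RatFun3 K), (∀ i, y i ∈ E) → z ∈ E) :
    z ∈ IntermediateField.adjoin K (Set.range y) :=
  h _ fun i => IntermediateField.subset_adjoin K _ ⟨i, rfl⟩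

lemma two_ne_zero_ratFun3 (h2 : (2 : K) ≠ 0) : (2 : RatFun3 K) ≠ 0 := by
  have := (map_ne_zero (algebraMap K (RatFun3 K))).2 h2
  rwa [map_ofNat] at this

lemma fixes_adjoin (y : Fin 3 → RatFun3 K) (g : RatFun3 K ≃ₐ[K] RatFun3 K)
    (h : ∀ i, g (y i) = y i) :
    ∀ z ∈ IntermediateField.adjoin K (Set.range y), g z = z := by
  intro z hz
  have : IntermediateField.adjoin K (Set.range y) ≤
      IntermediateField.fixedField (Subgroup.closure {g, g}) := by
    rw [IntermediateField.adjoin_le_iff]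
    rintro _ ⟨i, rfl⟩
    exact (mem_fixedField_closure_pair g g _).2 ⟨h i, h i⟩
  exact ((mem_fixedField_closure_pair g g _).1 (this hz)).1

/-- If `g₁` fixes `K(y)`, over which `K(x)` is quadratic, and `g₂` acts on `y` as `sigmaR` does on
`x`, then the field fixed by `g₁` and `g₂` is the one of `problemR`. -/
theorem reducesTo_problemR (h2 : (2 : K) ≠ 0) {E : IntermediateField K (RatFun3 K)}
    {g₁ g₂ : RatFun3 K ≃ₐ[K] RatFun3 K} (hE : ∀ z, z ∈ E ↔ g₁ z = z ∧ g₂ z = z) {a b c : Kˣ}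
    (y : Fin 3 → RatFun3 K) (w : RatFun3 K) (h₁ : ∀ i, g₁ (y i) = y i) (h₂0 : g₂ (y 0) = -y 0)
    (h₂1 : g₂ (y 1) = const (a : K) / y 1)
    (h₂2 : g₂ (y 2) = (-const (b : K) * y 0 ^ 2 + const (c : K)) / y 2)
    (hw0 : w ≠ 0) (h₁w : g₁ w = -w)
    (hw : ∀ E : IntermediateField K (RatFun3 K), (∀ i, y i ∈ E) → w ^ 2 ∈ E)
    (hgen : ∀ E : IntermediateField K (RatFun3 K), (∀ i, y i ∈ E) → w ∈ E → ∀ i, x i ∈ E) :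
    ReducesTo E (problemR a b c) := by
  have hy : AlgebraicIndependent K y := algebraicIndependent_of_sq_mem y {w}
    (by simpa using mem_of_forall_mem y hw) fun E hE hE' => hgen E hE (hE' w rfl)
  have hj : ∀ z, substHom y hy (sigmaR a b c z) = g₂ (substHom y hy z) := by
    have : (substHom y hy).comp (sigmaR a b c).toAlgHom = g₂.toAlgHom.comp (substHom y hy) := by
      obtain ⟨s0, s1, s2⟩ := sigmaR_x a b c
      refine algHom_ext fun i => ?_
      fin_cases i
      · simp [s0, substHom_x, h₂0]
      · simp [s1, substHom_x, h₂1, map_const]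
      · simp [s2, substHom_x, h₂2, map_const]
    exact fun z => DFunLike.congr_fun this z
  refine ReducesTo.symm (reducesTo_of_map_eq (substHom y hy) fun z => ?_)
  rw [hE]
  constructor
  · rintro ⟨hz₁, hz₂⟩
    have hz : z ∈ IntermediateField.adjoin K (Set.range y) := by
      refine mem_of_fixed_of_sq_mem (two_ne_zero_ratFun3 h2) _ (mem_of_forall_mem y hw) hw0 g₁
        (fixes_adjoin y g₁ h₁) h₁w hz₁ fun E' hE' hw' => ?_
      rw [eq_top_of_x_mem E' (hgen E' (fun i => hE' ?_) hw')]
      · exact IntermediateField.mem_top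
      exact IntermediateField.subset_adjoin K _ ⟨i, rfl⟩
    obtain ⟨z', rfl⟩ := mem_range_substHom y hy hz
    refine ⟨z', mem_problemR.2 ((substHom y hy).toRingHom.injective ?_), rfl⟩
    exact (hj z').trans hz₂
  · rintro ⟨z', hz', rfl⟩
    refine ⟨?_, by rw [← hj, mem_problemR.1 hz']⟩
    exact fixes_adjoin y g₁ h₁ _ (hy.aevalEquivField z').2

/-- If `g₁` and `g₂` fix `t`, and `K(x)` is generated over `K(t)` by square roots `w₁`, `w₂` on
which `g₁`, `g₂` act by signs, then the field fixed by `g₁` and `g₂` is `K(t)`. -/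
theorem affirmative_of_generators (h2 : (2 : K) ≠ 0) {E : IntermediateField K (RatFun3 K)}
    {g₁ g₂ : RatFun3 K ≃ₐ[K] RatFun3 K} (hE : ∀ z, z ∈ E ↔ g₁ z = z ∧ g₂ z = z)
    (t : Fin 3 → RatFun3 K) (w₁ w₂ : RatFun3 K) (h₁ : ∀ i, g₁ (t i) = t i)
    (h₂ : ∀ i, g₂ (t i) = t i) (hw₁0 : w₁ ≠ 0) (hw₂0 : w₂ ≠ 0)
    (h₁w₁ : g₁ w₁ = -w₁) (h₁w₂ : g₁ w₂ = w₂) (h₂w₂ : g₂ w₂ = -w₂)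
    (hw₁ : ∀ E : IntermediateField K (RatFun3 K), (∀ i, t i ∈ E) → w₁ ^ 2 ∈ E)
    (hw₂ : ∀ E : IntermediateField K (RatFun3 K), (∀ i, t i ∈ E) → w₂ ^ 2 ∈ E)
    (hgen : ∀ E : IntermediateField K (RatFun3 K), (∀ i, t i ∈ E) → w₁ ∈ E → w₂ ∈ E →
      ∀ i, x i ∈ E) : Affirmative E := by
  have ht : AlgebraicIndependent K t := algebraicIndependent_of_sq_mem t {w₁, w₂}
    (by simpa using ⟨mem_of_forall_mem t hw₁, mem_of_forall_mem t hw₂⟩)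
    fun E hE hE' => hgen E hE (hE' w₁ (by simp)) (hE' w₂ (by simp))
  set T := IntermediateField.adjoin K (Set.range t) with hT
  have htT : ∀ i, t i ∈ T := fun i => IntermediateField.subset_adjoin K _ ⟨i, rfl⟩
  have h2' := two_ne_zero_ratFun3 h2
  have hET : T = E := by
    ext z
    rw [hE]
    refine ⟨fun hz => ⟨fixes_adjoin t g₁ h₁ z hz, fixes_adjoin t g₂ h₂ z hz⟩, fun ⟨hz₁, hz₂⟩ => ?_⟩
    let T' := IntermediateField.adjoin K (Set.range t ∪ {w₂})
    have hTT' : T ≤ T' := IntermediateField.adjoin.mono K _ _ Set.subset_union_left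
    have hwT' : w₂ ∈ T' := IntermediateField.subset_adjoin K _ (by simp)
    have hz' : z ∈ T' := by
      refine mem_of_fixed_of_sq_mem h2' T' (hw₁ T' fun i => hTT' (htT i)) hw₁0 g₁ ?_ h₁w₁ hz₁
        fun E' hE' hw' => ?_
      · intro z hz
        have : T' ≤ IntermediateField.fixedField (Subgroup.closure {g₁, g₁}) := by
          rw [IntermediateField.adjoin_le_iff]
          rintro _ (⟨i, rfl⟩ | rfl)
          · exact (mem_fixedField_closure_pair g₁ g₁ _).2 ⟨h₁ i, h₁ i⟩
          · exact (mem_fixedField_closure_pair g₁ g₁ _).2 ⟨h₁w₂, h₁w₂⟩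
        exact ((mem_fixedField_closure_pair g₁ g₁ _).1 (this hz)).1
      · rw [eq_top_of_x_mem E' (hgen E' (fun i => hE' (hTT' (htT i))) hw' (hE' hwT'))]
        exact IntermediateField.mem_top
    refine mem_of_fixed_of_sq_mem h2' T (hw₂ T htT) hw₂0 g₂ (fixes_adjoin t g₂ h₂) h₂w₂ hz₂
      fun E' hE' hw' => ?_
    have : T' ≤ E' := by
      rw [IntermediateField.adjoin_le_iff]
      rintro _ (⟨i, rfl⟩ | rfl)
      · exact hE' (htT i)
      · exact hw'
    exact this hz'
  exact ⟨3, ⟨(IntermediateField.equivOfEq hET.symm).trans ht.aevalEquivField.symm⟩⟩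

@[simp]
lemma sgn_one : sgn K 1 = 1 := by simp [sgn, const]

@[simp]
lemma sgn_neg_one : sgn K (-1) = -1 := by simp [sgn, const]

lemma algebraMap_C (a : K) :
    algebraMap (MvPolynomial (Fin 3) K) (RatFun3 K) (MvPolynomial.C a) = const a := rfl

lemma algebraMap_X (i : Fin 3) :
    algebraMap (MvPolynomial (Fin 3) K) (RatFun3 K) (MvPolynomial.X i) = x i := rfl

lemma algebraMap_ne_zero_of_eval {p : MvPolynomial (Fin 3) K} (v : Fin 3 → K)
    (h : MvPolynomial.eval v p ≠ 0) :
    algebraMap (MvPolynomial (Fin 3) K) (RatFun3 K) p ≠ 0 := by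
  intro hp
  have : p = 0 := IsFractionRing.injective (MvPolynomial (Fin 3) K) (RatFun3 K) (by simpa using hp)
  simp [this] at h

lemma x_sq_sub_ne_zero (i : Fin 3) (a : Kˣ) : (x i ^ 2 - const (a : K) : RatFun3 K) ≠ 0 := by
  have := algebraMap_ne_zero_of_eval (p := MvPolynomial.X i ^ 2 - MvPolynomial.C (a : K)) 0
    (by simp)
  simpa [algebraMap_X, algebraMap_C] using this

lemma x_sq_add_ne_zero (i : Fin 3) (a : Kˣ) : (x i ^ 2 + const (a : K) : RatFun3 K) ≠ 0 := by
  have := algebraMap_ne_zero_of_eval (p := MvPolynomial.X i ^ 2 + MvPolynomial.C (a : K)) 0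
    (by simp)
  simpa [algebraMap_X, algebraMap_C] using this

lemma const_mul_x_sq_sub_ne_zero {i j : Fin 3} (hij : i ≠ j) (a b : Kˣ) :
    (const (a : K) * x i ^ 2 - const (b : K) * x j ^ 2 : RatFun3 K) ≠ 0 := by
  have := algebraMap_ne_zero_of_eval (p := MvPolynomial.C (a : K) * MvPolynomial.X i ^ 2 -
    MvPolynomial.C (b : K) * MvPolynomial.X j ^ 2) (Pi.single i 1) (by simp [hij.symm])
  simpa [algebraMap_X, algebraMap_C] using this

/-- For an involution `Z ↦ c / Z`, the invariant part of `Z`. -/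
def plusPart (c Z : RatFun3 K) : RatFun3 K := (Z + c / Z) / 2

/-- For an involution `Z ↦ c / Z`, the anti-invariant part of `Z`. -/
def minusPart (c Z : RatFun3 K) : RatFun3 K := (Z - c / Z) / 2

lemma plusPart_add_minusPart (h2 : (2 : RatFun3 K) ≠ 0) (c Z : RatFun3 K) :
    plusPart c Z + minusPart c Z = Z := by
  rw [plusPart, minusPart, ← add_div, add_add_sub_cancel, ← two_mul, mul_div_cancel_left₀ _ h2]

lemma plusPart_sq (h2 : (2 : RatFun3 K) ≠ 0) (c : RatFun3 K) {Z : RatFun3 K} (hZ : Z ≠ 0) :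
    plusPart c Z ^ 2 = minusPart c Z ^ 2 + c := by
  unfold plusPart minusPart
  field_simp
  ring

lemma minusPart_ne_zero (h2 : (2 : RatFun3 K) ≠ 0) (i : Fin 3) (a : Kˣ) :
    minusPart (const (a : K)) (x i) ≠ 0 := by
  have h := x_sq_sub_ne_zero i a
  have := x_ne_zero (K := K) i
  intro h'
  apply h
  unfold minusPart at h'
  field_simp at h'
  linear_combination h'

lemma plusPart_ne_zero (h2 : (2 : RatFun3 K) ≠ 0) (i : Fin 3) (a : Kˣ) :
    plusPart (const (a : K)) (x i) ≠ 0 := by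
  have h := x_sq_add_ne_zero i a
  have := x_ne_zero (K := K) i
  intro h'
  apply h
  unfold plusPart at h'
  field_simp at h'
  linear_combination h'

section action

variable {f : RatFun3 K ≃ₐ[K] RatFun3 K} {a : K} {Z : RatFun3 K}

lemma map_parts_fix (h : f Z = Z) :
    f (plusPart (const a) Z) = plusPart (const a) Z ∧
      f (minusPart (const a) Z) = minusPart (const a) Z := by
  simp only [plusPart, minusPart, map_div₀, map_add, map_sub, map_const, map_ofNat, h, and_self]

lemma map_parts_neg (h : f Z = -Z) :
    f (plusPart (const a) Z) = -plusPart (const a) Z ∧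
      f (minusPart (const a) Z) = -minusPart (const a) Z := by
  simp only [plusPart, minusPart, map_div₀, map_add, map_sub, map_const, map_ofNat, h, div_neg]
  constructor <;> ring

lemma map_parts_inv (ha : const a ≠ (0 : RatFun3 K)) (hZ : Z ≠ 0) (h : f Z = const a / Z) :
    f (plusPart (const a) Z) = plusPart (const a) Z ∧
      f (minusPart (const a) Z) = -minusPart (const a) Z := by
  simp only [plusPart, minusPart, map_div₀, map_add, map_sub, map_const, map_ofNat, h,
    div_div_cancel₀ ha]
  constructor <;> ring

lemma map_parts_neg_inv (ha : const a ≠ (0 : RatFun3 K)) (hZ : Z ≠ 0) (h : f Z = -const a / Z) :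
    f (plusPart (const a) Z) = -plusPart (const a) Z ∧
      f (minusPart (const a) Z) = minusPart (const a) Z := by
  have h' : const a / (-const a / Z) = -Z := by field_simp
  simp only [plusPart, minusPart, map_div₀, map_add, map_sub, map_const, map_ofNat, h, h']
  constructor <;> ring

end action

/-- Two conics with a common slot: the norm of `D - y P`. -/
lemma sub_mul_mul_add_mul {D C P A b c y : RatFun3 K}
    (hD : D ^ 2 = C ^ 2 + c) (hP : P ^ 2 = A ^ 2 + b) (hy : y * A = C) :
    (D + y * P) * (D - y * P) = -b * y ^ 2 + c := by
  subst hy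
  linear_combination hD - y ^ 2 * hP

/-- A field that contains `y ≠ 0` and `D - y P` contains `D` and `P`. -/
lemma mem_of_sub_mul_mem (h2 : (2 : RatFun3 K) ≠ 0) (E : IntermediateField K (RatFun3 K))
    {D P y n : RatFun3 K} (hn : (D + y * P) * (D - y * P) = n) (hy0 : y ≠ 0)
    (hv0 : D - y * P ≠ 0) (hy : y ∈ E) (hv : D - y * P ∈ E) (hnE : n ∈ E) : D ∈ E ∧ P ∈ E := by
  have hw : D + y * P ∈ E := by
    have : D + y * P = n / (D - y * P) := by rw [eq_div_iff hv0, hn]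
    exact this ▸ E.div_mem hnE hv
  have h2E : (2 : RatFun3 K) ∈ E := ofNat_mem E 2
  have hD : D ∈ E := mem_of_mul_mem E h2E h2 (by
    have := E.add_mem hv hw
    ring_nf at this ⊢
    exact this)
  refine ⟨hD, mem_of_mul_mem E hy hy0 ?_⟩
  have := E.sub_mem hw hD
  rwa [add_sub_cancel_left] at this

lemma quad_mem (E : IntermediateField K (RatFun3 K)) {y : RatFun3 K} (hy : y ∈ E) (b c : K) :
    -const b * y ^ 2 + const c ∈ E :=
  E.add_mem (E.mul_mem (E.neg_mem (const_mem E b)) (pow_mem hy 2)) (const_mem E c)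

theorem reducesTo_problemR_one_one_one (h2 : (2 : K) ≠ 0) (a b c : Kˣ) :
    ReducesTo (noether3311 1 1 1 a b c) (problemR a b c) := by
  have h2' := two_ne_zero_ratFun3 h2
  obtain ⟨s0, s1, s2⟩ := sigma₁_x (K := K) 1 b c
  obtain ⟨t0, t1, t2⟩ := sigma₂_x (K := K) 1 1 a c
  simp only [sgn_one, one_mul] at s0 t1 t2
  have hY0 := x_ne_zero (K := K) 1
  have hZ0 := x_ne_zero (K := K) 2
  have hb := const_ne_zero (K := K) b
  have hc := const_ne_zero (K := K) c
  have hA0 := minusPart_ne_zero h2' 1 b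
  have hC0 := minusPart_ne_zero h2' 2 c
  have hYZ := const_mul_x_sq_sub_ne_zero (K := K) (i := 1) (j := 2) (by decide) c b
  obtain ⟨sP, sA⟩ := map_parts_inv hb hY0 s1
  obtain ⟨sD, sC⟩ := map_parts_inv hc hZ0 s2
  obtain ⟨tP, tA⟩ := map_parts_fix (a := (b : K)) t1
  obtain ⟨tD, tC⟩ := map_parts_inv hc hZ0 t2
  have hPA := plusPart_sq h2' (const (b : K)) hY0
  have hDC := plusPart_sq h2' (const (c : K)) hZ0
  have hne : plusPart (const (c : K)) (x 2) * minusPart (const (b : K)) (x 1) -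
      minusPart (const (c : K)) (x 2) * plusPart (const (b : K)) (x 1) ≠ 0 := by
    intro h
    apply hYZ
    unfold plusPart minusPart at h
    field_simp at h
    have : 2 * (const (c : K) * x 1 ^ 2 - const (b : K) * x 2 ^ 2) = 0 := by linear_combination h
    simpa [h2'] using this
  have hY := plusPart_add_minusPart h2' (const (b : K)) (x 1)
  have hZ := plusPart_add_minusPart h2' (const (c : K)) (x 2)
  generalize minusPart (const (b : K)) (x 1) = A at *
  generalize plusPart (const (b : K)) (x 1) = P at *
  generalize minusPart (const (c : K)) (x 2) = C at *
  generalize plusPart (const (c : K)) (x 2) = D at *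
  have hyA : C / A * A = C := by field_simp
  have hy0 : C / A ≠ 0 := div_ne_zero hC0 hA0
  have hnorm := sub_mul_mul_add_mul hDC hPA hyA
  have hv0 : D - C / A * P ≠ 0 := by
    intro h
    apply hne
    field_simp at h
    linear_combination h
  refine reducesTo_problemR h2 (fun z => mem_noether3311) ![C / A, x 0, D - C / A * P] A
    ?_ ?_ ?_ ?_ hA0 sA ?_ ?_
  · simp [Fin.forall_fin_succ, s0, sA, sC, sP, sD]
  · simp [tA, tC, neg_div]
  · simp [t0]
  · simp only [Matrix.cons_val, map_sub, map_mul, map_div₀, tA, tC, tP, tD]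
    rw [eq_div_iff hv0]
    linear_combination hnorm
  · intro E hE
    obtain ⟨hD, hP⟩ := mem_of_sub_mul_mem h2' E hnorm hy0 hv0 (hE 0) (hE 2) (quad_mem E (hE 0) _ _)
    have : A ^ 2 = P ^ 2 - const (b : K) := by linear_combination -hPA
    exact this ▸ E.sub_mem (pow_mem hP 2) (const_mem E _)
  · intro E hE hA
    obtain ⟨hD, hP⟩ := mem_of_sub_mul_mem h2' E hnorm hy0 hv0 (hE 0) (hE 2) (quad_mem E (hE 0) _ _)
    have hC : C ∈ E := hyA ▸ E.mul_mem (hE 0) hA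
    rw [Fin.forall_fin_succ, Fin.forall_fin_two]
    exact ⟨hE 1, hY ▸ E.add_mem hP hA, hZ ▸ E.add_mem hD hC⟩

/-- Signs `-1, -1, 1`. -/
theorem reducesTo_problemR_neg_neg_one (h2 : (2 : K) ≠ 0) (a b c : Kˣ) :
    ReducesTo (noether3311 (-1) (-1) 1 a b c) (problemR c b a) := by
  have h2' := two_ne_zero_ratFun3 h2
  obtain ⟨s0, s1, s2⟩ := sigma₁_x (K := K) (-1) b c
  obtain ⟨t0, t1, t2⟩ := sigma₂_x (K := K) (-1) 1 a c
  simp only [sgn_one, sgn_neg_one, one_mul, neg_mul] at s0 t1 t2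
  have hX0 := x_ne_zero (K := K) 0
  have hY0 := x_ne_zero (K := K) 1
  have hZ0 := x_ne_zero (K := K) 2
  have ha := const_ne_zero (K := K) a
  have hb := const_ne_zero (K := K) b
  have hc := const_ne_zero (K := K) c
  have hA0 := plusPart_ne_zero h2' 1 b
  have hC0 := plusPart_ne_zero h2' 0 a
  have hYZ := const_mul_x_sq_sub_ne_zero (K := K) (i := 0) (j := 1) (by decide) b a
  obtain ⟨sA, sP⟩ := map_parts_inv hb hY0 s1
  obtain ⟨sC, sD⟩ := map_parts_neg (a := (a : K)) s0
  obtain ⟨tA, tP⟩ := map_parts_neg (a := (b : K)) t1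
  obtain ⟨tC, tD⟩ := map_parts_inv ha hX0 t0
  have hPA := plusPart_sq h2' (const (b : K)) hY0
  have hDC := plusPart_sq h2' (const (a : K)) hX0
  have hne : minusPart (const (a : K)) (x 0) * plusPart (const (b : K)) (x 1) -
      plusPart (const (a : K)) (x 0) * minusPart (const (b : K)) (x 1) ≠ 0 := by
    intro h
    apply hYZ
    unfold plusPart minusPart at h
    field_simp at h
    have : 2 * (const (b : K) * x 0 ^ 2 - const (a : K) * x 1 ^ 2) = 0 := by linear_combination h
    simpa [h2'] using this
  have hX := plusPart_add_minusPart h2' (const (a : K)) (x 0)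
  have hY := plusPart_add_minusPart h2' (const (b : K)) (x 1)
  generalize minusPart (const (b : K)) (x 1) = P at *
  generalize plusPart (const (b : K)) (x 1) = A at *
  generalize minusPart (const (a : K)) (x 0) = D at *
  generalize plusPart (const (a : K)) (x 0) = C at *
  have hyA : C / A * A = C := by field_simp
  have hy0 : C / A ≠ 0 := div_ne_zero hC0 hA0
  have hnorm : (D + C / A * P) * (D - C / A * P) =
      -(-const (b : K) * (C / A) ^ 2 + const (a : K)) := by
    rw [sub_mul_mul_add_mul (b := -const (b : K)) (c := -const (a : K))
      (by linear_combination -hDC) (by linear_combination -hPA) hyA]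
    ring
  have hv0 : D - C / A * P ≠ 0 := by
    intro h
    apply hne
    field_simp at h
    linear_combination h
  refine reducesTo_problemR h2 (g₁ := sigma₁ (-1) b c * sigma₂ (-1) 1 a c) (g₂ := sigma₁ (-1) b c)
    (fun z => ?_) ![C / A, x 2, D - C / A * P] A ?_ ?_ ?_ ?_ hA0 ?_ ?_ ?_
  · rw [mem_noether3311, AlgEquiv.mul_apply]
    refine ⟨fun ⟨h, h'⟩ => ⟨by rw [h', h], h⟩, fun ⟨h, h'⟩ => ⟨h', ?_⟩⟩
    exact (sigma₁ (-1) b c).injective (h.trans h'.symm)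
  · simp [Fin.forall_fin_succ, s2, tA, tC, tP, tD, sA, sC, sP, sD, t2, map_const, div_div_cancel₀ hc,
      neg_div, div_neg]
  · simp [sA, sC, neg_div]
  · simp [s2]
  · simp only [Matrix.cons_val, map_sub, map_mul, map_div₀, sA, sC, sP, sD]
    rw [eq_div_iff hv0]
    linear_combination -hnorm
  · simp [sA, tA]
  · intro E hE
    obtain ⟨hD, hP⟩ := mem_of_sub_mul_mem h2' E hnorm hy0 hv0 (hE 0) (hE 2)
      (E.neg_mem (quad_mem E (hE 0) _ _))
    exact hPA ▸ E.add_mem (pow_mem hP 2) (const_mem E _)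
  · intro E hE hA
    obtain ⟨hD, hP⟩ := mem_of_sub_mul_mem h2' E hnorm hy0 hv0 (hE 0) (hE 2)
      (E.neg_mem (quad_mem E (hE 0) _ _))
    have hC : C ∈ E := hyA ▸ E.mul_mem (hE 0) hA
    rw [Fin.forall_fin_succ, Fin.forall_fin_two]
    exact ⟨hX ▸ E.add_mem hC hD, hY ▸ E.add_mem hA hP, hE 1⟩

/-- Signs `1, 1, -1`. -/
theorem affirmative_one_one_neg (h2 : (2 : K) ≠ 0) (a b c : Kˣ) :
    Affirmative (noether3311 1 1 (-1) a b c) := by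
  have h2' := two_ne_zero_ratFun3 h2
  obtain ⟨s0, s1, s2⟩ := sigma₁_x (K := K) 1 b c
  obtain ⟨t0, t1, t2⟩ := sigma₂_x (K := K) 1 (-1) a c
  simp only [sgn_one, sgn_neg_one, one_mul, neg_mul] at s0 t1 t2
  have hX0 := x_ne_zero (K := K) 0
  have hY0 := x_ne_zero (K := K) 1
  have hZ0 := x_ne_zero (K := K) 2
  have ha := const_ne_zero (K := K) a
  have hb := const_ne_zero (K := K) b
  have hc := const_ne_zero (K := K) c
  have hA0 := minusPart_ne_zero h2' 1 b
  have hC0 := minusPart_ne_zero h2' 2 c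
  have hD0 := plusPart_ne_zero h2' 2 c
  have hW0 := minusPart_ne_zero h2' 0 a
  obtain ⟨sQ, sW⟩ := map_parts_fix (a := (a : K)) s0
  obtain ⟨sP, sA⟩ := map_parts_inv hb hY0 s1
  obtain ⟨sD, sC⟩ := map_parts_inv hc hZ0 s2
  obtain ⟨tQ, tW⟩ := map_parts_inv ha hX0 t0
  obtain ⟨tP, tA⟩ := map_parts_fix (a := (b : K)) t1
  obtain ⟨tD, tC⟩ := map_parts_neg_inv hc hZ0 t2
  have hQW := plusPart_sq h2' (const (a : K)) hX0
  have hPA := plusPart_sq h2' (const (b : K)) hY0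
  have hDC := plusPart_sq h2' (const (c : K)) hZ0
  have hne : plusPart (const (a : K)) (x 0) * plusPart (const (c : K)) (x 2) *
      minusPart (const (b : K)) (x 1) - minusPart (const (a : K)) (x 0) *
      minusPart (const (c : K)) (x 2) * plusPart (const (b : K)) (x 1) ≠ 0 := by
    intro h
    have hp := algebraMap_ne_zero_of_eval (p := MvPolynomial.X 0 ^ 2 * (MvPolynomial.C (c : K) *
      MvPolynomial.X 1 ^ 2 - MvPolynomial.C (b : K) * MvPolynomial.X 2 ^ 2) +
      MvPolynomial.C (a : K) * (MvPolynomial.X 1 ^ 2 * MvPolynomial.X 2 ^ 2 -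
      MvPolynomial.C (b : K) * MvPolynomial.C (c : K))) 0 (by simp)
    apply hp
    simp only [map_add, map_sub, map_mul, map_pow, algebraMap_X, algebraMap_C]
    unfold plusPart minusPart at h
    field_simp at h
    refine (mul_eq_zero.1 (?_ : (2 : RatFun3 K) * _ = 0)).resolve_left h2'
    linear_combination h
  have hX := plusPart_add_minusPart h2' (const (a : K)) (x 0)
  have hY := plusPart_add_minusPart h2' (const (b : K)) (x 1)
  have hZ := plusPart_add_minusPart h2' (const (c : K)) (x 2)
  generalize minusPart (const (a : K)) (x 0) = W at *
  generalize plusPart (const (a : K)) (x 0) = Q at *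
  generalize minusPart (const (b : K)) (x 1) = A at *
  generalize plusPart (const (b : K)) (x 1) = P at *
  generalize minusPart (const (c : K)) (x 2) = C at *
  generalize plusPart (const (c : K)) (x 2) = D at *
  have hyA : C / A * A = C := by field_simp
  have hy0 : C / A ≠ 0 := div_ne_zero hC0 hA0
  have huD : W / D * D = W := by field_simp
  have hu0 : W / D ≠ 0 := div_ne_zero hW0 hD0
  have hnorm : (Q + W / D * (C / A * P)) * (Q - W / D * (C / A * P)) =
      const (a : K) + (W / D) ^ 2 * (-const (b : K) * (C / A) ^ 2 + const (c : K)) := by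
    have h1 := sub_mul_mul_add_mul hDC hPA hyA
    have h3 : (W / D * D) ^ 2 = W ^ 2 := by rw [huD]
    linear_combination hQW + (W / D) ^ 2 * h1 - h3
  have hv0 : Q - W / D * (C / A * P) ≠ 0 := by
    intro h
    apply hne
    field_simp at h
    linear_combination h
  have key : ∀ E : IntermediateField K (RatFun3 K), C / A ∈ E → W / D ∈ E →
      Q - W / D * (C / A * P) ∈ E → Q ∈ E ∧ P ∈ E := by
    intro E hy hu hv
    obtain ⟨hQ, hP⟩ := mem_of_sub_mul_mem h2' E hnorm hu0 hv0 hu hv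
      (E.add_mem (const_mem E _) (E.mul_mem (pow_mem hu 2) (quad_mem E hy _ _)))
    exact ⟨hQ, mem_of_mul_mem E hy hy0 hP⟩
  refine affirmative_of_generators h2 (fun z => mem_noether3311)
    ![C / A, W / D, Q - W / D * (C / A * P)] A W ?_ ?_ hA0 hW0 sA sW tW ?_ ?_ ?_
  · simp [Fin.forall_fin_succ, sA, sC, sP, sD, sQ, sW]
  · simp [Fin.forall_fin_succ, tA, tC, tP, tD, tQ, tW]
  · intro E hE
    obtain ⟨hQ, hP⟩ := key E (hE 0) (hE 1) (hE 2)
    have : A ^ 2 = P ^ 2 - const (b : K) := by linear_combination -hPA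
    exact this ▸ E.sub_mem (pow_mem hP 2) (const_mem E _)
  · intro E hE
    obtain ⟨hQ, hP⟩ := key E (hE 0) (hE 1) (hE 2)
    have : W ^ 2 = Q ^ 2 - const (a : K) := by linear_combination -hQW
    exact this ▸ E.sub_mem (pow_mem hQ 2) (const_mem E _)
  · intro E hE hA hW
    obtain ⟨hQ, hP⟩ := key E (hE 0) (hE 1) (hE 2)
    have hC : C ∈ E := hyA ▸ E.mul_mem (hE 0) hA
    have hD : D ∈ E := mem_of_mul_mem E (hE 1) hu0 (huD.symm ▸ hW)
    rw [Fin.forall_fin_succ, Fin.forall_fin_two]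
    exact ⟨hX ▸ E.add_mem hQ hW, hY ▸ E.add_mem hP hA, hZ ▸ E.add_mem hD hC⟩

/-- Two automorphisms of `K(x)` that are intertwined by `ψ` on the variables are intertwined. -/
lemma intertwine {ψ g g' : RatFun3 K ≃ₐ[K] RatFun3 K} (h : ∀ i, ψ (g (x i)) = g' (ψ (x i)))
    (z : RatFun3 K) : ψ (g z) = g' (ψ z) := by
  have : ψ.toAlgHom.comp g.toAlgHom = g'.toAlgHom.comp ψ.toAlgHom := algHom_ext h
  exact DFunLike.congr_fun this z

lemma reducesTo_of_equiv {E E' : IntermediateField K (RatFun3 K)}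
    (ψ : RatFun3 K ≃ₐ[K] RatFun3 K) (h : ∀ z, z ∈ E ↔ ψ z ∈ E') : ReducesTo E E' :=
  reducesTo_of_map_eq ψ.toAlgHom fun z => ⟨fun hz =>
    ⟨ψ.symm z, (h _).2 (by simpa using hz), by simp⟩, by rintro ⟨z', hz', rfl⟩; exact (h _).1 hz'⟩

/-- The automorphism of `K(x)` that permutes the variables. -/
def permAut (π : Equiv.Perm (Fin 3)) : RatFun3 K ≃ₐ[K] RatFun3 K :=
  substAut (fun i => x (π i)) <| adjoin_range_eq_top _ fun E h i => by
    simpa using h (π.symm i)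

lemma permAut_x (π : Equiv.Perm (Fin 3)) (i : Fin 3) :
    permAut (K := K) π (x i) = x (π i) := substAut_x _ _ i

lemma const_mul (a b : K) : (const (a * b) : RatFun3 K) = const a * const b := by simp [const]

theorem reducesTo_swap₁₂ {ε₁ ε₂ ε₃ : ℤˣ} {a b c c' : Kˣ} (hc : (c' : K) = ((ε₃ : ℤ) : K) * c) :
    ReducesTo (noether3311 ε₁ ε₂ ε₃ a b c) (noether3311 ε₂ ε₁ ε₃ b a c') := by
  have hc' : (const (c' : K) : RatFun3 K) = sgn K ε₃ * const (c : K) := by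
    rw [hc, const_mul, sgn]
  obtain ⟨s0, s1, s2⟩ := sigma₁_x (K := K) ε₁ b c
  obtain ⟨t0, t1, t2⟩ := sigma₂_x (K := K) ε₂ ε₃ a c
  obtain ⟨s0', s1', s2'⟩ := sigma₁_x (K := K) ε₂ a c'
  obtain ⟨t0', t1', t2'⟩ := sigma₂_x (K := K) ε₁ ε₃ b c'
  have hψ := permAut_x (K := K) (Equiv.swap 0 1)
  have hp0 := hψ 0
  have hp1 := hψ 1
  have hp2 := hψ 2
  simp only [Equiv.swap_apply_left, Equiv.swap_apply_right,
    Equiv.swap_apply_of_ne_of_ne (show (2 : Fin 3) ≠ 0 by decide) (show (2 : Fin 3) ≠ 1 by decide)]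
    at hp0 hp1 hp2
  have hS := intertwine (ψ := permAut (Equiv.swap 0 1)) (g := sigma₁ ε₁ b c)
    (g' := sigma₂ ε₁ ε₃ b c') (fun i => by
      fin_cases i
      · simp [s0, hp0, t1', sgn, map_const]
      · simp [s1, hp1, t0', map_const]
      · simp [s2, hp2, t2', map_const, hc', ← mul_assoc, sgn_mul_self])
  have hT := intertwine (ψ := permAut (Equiv.swap 0 1)) (g := sigma₂ ε₂ ε₃ a c)
    (g' := sigma₁ ε₂ a c') (fun i => by
      fin_cases i
      · simp [t0, hp0, s1', map_const]
      · simp [t1, hp1, s0', sgn, map_const]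
      · simp [t2, hp2, s2', map_const, hc', sgn])
  refine reducesTo_of_equiv (permAut (Equiv.swap 0 1)) fun z => ?_
  rw [mem_noether3311, mem_noether3311, ← hS, ← hT]
  simp [and_comm]

theorem reducesTo_swap₂₃ {ε₁ ε₂ ε₃ : ℤˣ} {a a' b c : Kˣ} (ha : (a' : K) = ((ε₁ : ℤ) : K) * a) :
    ReducesTo (noether3311 ε₁ ε₂ ε₃ a b c) (noether3311 ε₁ ε₃ ε₂ a' c b) := by
  have ha' : (const (a' : K) : RatFun3 K) = sgn K ε₁ * const (a : K) := by
    rw [ha, const_mul, sgn]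
  obtain ⟨s0, s1, s2⟩ := sigma₁_x (K := K) ε₁ b c
  obtain ⟨t0, t1, t2⟩ := sigma₂_x (K := K) ε₂ ε₃ a c
  obtain ⟨s0', s1', s2'⟩ := sigma₁_x (K := K) ε₁ c b
  obtain ⟨t0', t1', t2'⟩ := sigma₂_x (K := K) ε₃ ε₂ a' b
  have hψ := permAut_x (K := K) (Equiv.swap 1 2)
  have hp0 := hψ 0
  have hp1 := hψ 1
  have hp2 := hψ 2
  simp only [Equiv.swap_apply_left, Equiv.swap_apply_right,
    Equiv.swap_apply_of_ne_of_ne (show (0 : Fin 3) ≠ 1 by decide) (show (0 : Fin 3) ≠ 2 by decide)]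
    at hp0 hp1 hp2
  have hS := intertwine (ψ := permAut (Equiv.swap 1 2)) (g := sigma₁ ε₁ b c)
    (g' := sigma₁ ε₁ c b) (fun i => by
      fin_cases i
      · simp [s0, hp0, s0', sgn, map_const]
      · simp [s1, hp1, s2', map_const]
      · simp [s2, hp2, s1', map_const])
  have hb := const_ne_zero (K := K) b
  have hT := intertwine (ψ := permAut (Equiv.swap 1 2)) (g := sigma₂ ε₂ ε₃ a c)
    (g' := sigma₁ ε₁ c b * sigma₂ ε₃ ε₂ a' b) (fun i => by
      have h1 := sgn_mul_self (K := K) ε₁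
      have h10 := sgn_ne_zero (K := K) ε₁
      have hsgn : ∀ (f : RatFun3 K ≃ₐ[K] RatFun3 K) ε, f (sgn K ε) = sgn K ε :=
        fun f ε => map_const f _
      fin_cases i
      · simp only [Fin.zero_eta, t0, hp0, AlgEquiv.mul_apply, t0', map_div₀, map_mul, s0', map_const,
          ha', hsgn, mul_div_mul_left _ _ h10]
      · simp [t1, hp1, t2', s2', hsgn, map_const]
        field_simp
      · simp [t2, hp2, t1', s1', hsgn, map_const, mul_div_assoc])
  refine reducesTo_of_equiv (permAut (Equiv.swap 1 2)) fun z => ?_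
  rw [mem_noether3311, mem_noether3311]
  have hT' := hT z
  rw [AlgEquiv.mul_apply] at hT'
  have hz : ∀ w : RatFun3 K, w = z ↔ permAut (Equiv.swap 1 2) w = permAut (Equiv.swap 1 2) z :=
    fun w => (permAut (Equiv.swap 1 2)).injective.eq_iff.symm
  rw [hz, hz (sigma₂ ε₂ ε₃ a c z), hT', hS]
  refine and_congr_right fun h => ?_
  conv_lhs => rw [← h]
  rw [(sigma₁ ε₁ c b).injective.eq_iff, h]

/-- Scaling the first variable. -/
theorem reducesTo_scale {ε₁ ε₂ ε₃ : ℤˣ} {a a' b c : Kˣ} (m : Kˣ) (h : a = a' * m ^ 2) :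
    ReducesTo (noether3311 ε₁ ε₂ ε₃ a b c) (noether3311 ε₁ ε₂ ε₃ a' b c) := by
  have hm := const_ne_zero (K := K) m
  have ha' : (const (a : K) : RatFun3 K) = const (a' : K) * const (m : K) ^ 2 := by
    rw [h]; simp [const]
  let ψ : RatFun3 K ≃ₐ[K] RatFun3 K := substAut ![const (m : K) * x 0, x 1, x 2] <|
    adjoin_range_eq_top _ fun E h => by
      have h0 : const (m : K) * x 0 ∈ E := h 0
      rw [Fin.forall_fin_succ, Fin.forall_fin_two]
      exact ⟨mem_of_mul_mem E (const_mem E _) hm h0, h 1, h 2⟩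
  have hp0 : ψ (x 0) = const (m : K) * x 0 := substAut_x _ _ 0
  have hp1 : ψ (x 1) = x 1 := substAut_x _ _ 1
  have hp2 : ψ (x 2) = x 2 := substAut_x _ _ 2
  obtain ⟨s0, s1, s2⟩ := sigma₁_x (K := K) ε₁ b c
  obtain ⟨t0, t1, t2⟩ := sigma₂_x (K := K) ε₂ ε₃ a c
  obtain ⟨t0', t1', t2'⟩ := sigma₂_x (K := K) ε₂ ε₃ a' c
  have hsgn : ∀ (f : RatFun3 K ≃ₐ[K] RatFun3 K) ε, f (sgn K ε) = sgn K ε :=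
    fun f ε => map_const f _
  have hS := intertwine (ψ := ψ) (g := sigma₁ ε₁ b c) (g' := sigma₁ ε₁ b c) (fun i => by
      fin_cases i
      · simp [s0, hp0, hsgn, map_const]; ring
      · simp [s1, hp1, map_const]
      · simp [s2, hp2, map_const])
  have hX0 := x_ne_zero (K := K) 0
  have hT := intertwine (ψ := ψ) (g := sigma₂ ε₂ ε₃ a c) (g' := sigma₂ ε₂ ε₃ a' c) (fun i => by
      fin_cases i
      · simp [t0, hp0, t0', map_const, ha']; field_simp
      · simp [t1, hp1, t1', hsgn]
      · simp [t2, hp2, t2', hsgn, map_const])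
  refine reducesTo_of_equiv ψ fun z => ?_
  rw [mem_noether3311, mem_noether3311, ← hS, ← hT]
  simp

theorem problemR_swap₁₂ (h2 : (2 : K) ≠ 0) (a b c : Kˣ) :
    ReducesTo (problemR a b c) (problemR b a c) :=
  ((reducesTo_problemR_one_one_one h2 a b c).symm.trans
    (reducesTo_swap₁₂ (c' := c) (by simp))).trans (reducesTo_problemR_one_one_one h2 b a c)

theorem problemR_swap₂₃ (h2 : (2 : K) ≠ 0) (a b c : Kˣ) :
    ReducesTo (problemR a b c) (problemR a c b) :=
  ((reducesTo_problemR_one_one_one h2 a b c).symm.trans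
    (reducesTo_swap₂₃ (a' := a) (by simp))).trans (reducesTo_problemR_one_one_one h2 a c b)

theorem problemR_swap₁₃ (h2 : (2 : K) ≠ 0) (a b c : Kˣ) :
    ReducesTo (problemR a b c) (problemR c b a) :=
  ((problemR_swap₁₂ h2 a b c).trans (problemR_swap₂₃ h2 b a c)).trans (problemR_swap₁₂ h2 b c a)

/-- `x₃ ↦ x₂ x₃` changes the signs of the quadratic polynomial of `R(-1, b, c)`. -/
theorem problemR_neg_one_neg (b c : Kˣ) :
    ReducesTo (problemR (-1) b c) (problemR (-1) (-b) (-c)) := by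
  have hY0 := x_ne_zero (K := K) 1
  let ψ : RatFun3 K ≃ₐ[K] RatFun3 K := substAut ![x 0, x 1, x 1 * x 2] <|
    adjoin_range_eq_top _ fun E h => by
      have h2 : x 1 * x 2 ∈ E := h 2
      rw [Fin.forall_fin_succ, Fin.forall_fin_two]
      exact ⟨h 0, h 1, mem_of_mul_mem E (h 1) hY0 h2⟩
  have hp0 : ψ (x 0) = x 0 := substAut_x _ _ 0
  have hp1 : ψ (x 1) = x 1 := substAut_x _ _ 1
  have hp2 : ψ (x 2) = x 1 * x 2 := substAut_x _ _ 2
  obtain ⟨s0, s1, s2⟩ := sigmaR_x (K := K) (-1) b c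
  obtain ⟨t0, t1, t2⟩ := sigmaR_x (K := K) (-1) (-b) (-c)
  have hneg : ∀ u : K, (const (-u) : RatFun3 K) = -const u := fun u => by simp [const]
  have h1 : (const (1 : K) : RatFun3 K) = 1 := by simp [const]
  simp only [Units.val_neg, Units.val_one, hneg, h1] at s1 t1 t2
  have hZ0 := x_ne_zero (K := K) 2
  have hS := intertwine (ψ := ψ) (g := sigmaR (-1) b c) (g' := sigmaR (-1) (-b) (-c)) (fun i => by
      fin_cases i
      · simp [s0, hp0, t0]
      · simp [s1, hp1, t1]
      · simp [s2, hp0, hp2, t1, t2, map_const]; field_simp; ring)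
  refine reducesTo_of_equiv ψ fun z => ?_
  rw [mem_problemR, mem_problemR, ← hS]
  simp

/-- All signs `-1` and `a = 1`. -/
theorem reducesTo_problemR_neg_of_one (h2 : (2 : K) ≠ 0) (b c : Kˣ) :
    ReducesTo (noether3311 (-1) (-1) (-1) 1 b c) (problemR b (-1) c) := by
  have h2' := two_ne_zero_ratFun3 h2
  obtain ⟨s0, s1, s2⟩ := sigma₁_x (K := K) (-1) b c
  obtain ⟨t0, t1, t2⟩ := sigma₂_x (K := K) (-1) (-1) 1 c
  have hone : (const ((1 : Kˣ) : K) : RatFun3 K) = 1 := by simp [const]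
  have hnone : (const ((-1 : Kˣ) : K) : RatFun3 K) = -1 := by simp [const]
  simp only [sgn_neg_one, one_mul, neg_mul, hone] at s0 t0 t1 t2
  have hX0 := x_ne_zero (K := K) 0
  have hY0 := x_ne_zero (K := K) 1
  have hZ0 := x_ne_zero (K := K) 2
  have hc := const_ne_zero (K := K) c
  have hXm : (x 0 - 1 : RatFun3 K) ≠ 0 := by
    have := algebraMap_ne_zero_of_eval (p := (MvPolynomial.X 0 - 1 : MvPolynomial (Fin 3) K)) 0
      (by simp)
    simpa [algebraMap_X] using this
  have hXp : (x 0 + 1 : RatFun3 K) ≠ 0 := by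
    have := algebraMap_ne_zero_of_eval (p := (MvPolynomial.X 0 + 1 : MvPolynomial (Fin 3) K)) 0
      (by simp)
    simpa [algebraMap_X] using this
  have hD0 := plusPart_ne_zero h2' 2 c
  obtain ⟨sD, sC⟩ := map_parts_inv hc hZ0 s2
  obtain ⟨tD, tC⟩ := map_parts_neg_inv hc hZ0 t2
  have hDC := plusPart_sq h2' (const (c : K)) hZ0
  have hZ := plusPart_add_minusPart h2' (const (c : K)) (x 2)
  obtain ⟨w, hw⟩ : ∃ w : RatFun3 K, w = (x 0 - 1) / (x 0 + 1) := ⟨_, rfl⟩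
  have hw0 : w ≠ 0 := hw ▸ div_ne_zero hXm hXp
  have hXw : x 0 * (1 - w) = 1 + w := by rw [hw]; field_simp; ring
  have hw1 : 1 - w ≠ 0 := by
    intro h
    rw [h, mul_zero] at hXw
    exact h2' (by linear_combination h - hXw)
  have sw : sigma₁ (-1) b c w = 1 / w := by
    have hXm' : (-x 0 + 1 : RatFun3 K) ≠ 0 := fun h => hXm (by linear_combination -h)
    simp only [hw, map_div₀, map_sub, map_add, map_one, s0]
    field_simp
    ring
  have tw : sigma₂ (-1) (-1) 1 c w = -w := by
    have hXp' : (1 + x 0 : RatFun3 K) ≠ 0 := fun h => hXp (by linear_combination h)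
    simp only [hw, map_div₀, map_sub, map_add, map_one, t0]
    field_simp
    ring
  generalize minusPart (const (c : K)) (x 2) = C at *
  generalize plusPart (const (c : K)) (x 2) = D at *
  refine reducesTo_problemR h2 (g₁ := sigma₂ (-1) (-1) 1 c) (g₂ := sigma₁ (-1) b c)
    (fun z => mem_noether3311.trans and_comm) ![C, x 1 * w, w * D] D ?_ ?_ ?_ ?_ hD0 tD ?_ ?_
  · simp [Fin.forall_fin_succ, tC, tD, tw, t1]
  · simp [sC]
  · simp only [Matrix.cons_val, map_mul, s1, sw]
    field_simp
  · simp only [Matrix.cons_val, map_mul, sw, sD, hnone]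
    rw [eq_div_iff (mul_ne_zero hw0 hD0)]
    field_simp
    linear_combination hDC
  · intro E hE
    exact hDC ▸ E.add_mem (pow_mem (hE 0) 2) (const_mem E _)
  · intro E hE hD
    have h1 : x 1 * w ∈ E := hE 1
    have h3 : w * D ∈ E := hE 2
    have hwE : w ∈ E := mem_of_mul_mem E hD hD0 (mul_comm w D ▸ h3)
    rw [Fin.forall_fin_succ, Fin.forall_fin_two]
    refine ⟨mem_of_mul_mem E (E.sub_mem E.one_mem hwE) hw1 ?_,
      mem_of_mul_mem E hwE hw0 (mul_comm (x 1) w ▸ h1), hZ ▸ E.add_mem hD (hE 0)⟩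
    rw [mul_comm, hXw]
    exact E.add_mem E.one_mem hwE

/-- All signs `-1` and `a = b`. -/
theorem reducesTo_problemR_neg_of_eq (h2 : (2 : K) ≠ 0) (a c : Kˣ) :
    ReducesTo (noether3311 (-1) (-1) (-1) a a c) (problemR a c (-(a * c))) := by
  have h2' := two_ne_zero_ratFun3 h2
  obtain ⟨s0, s1, s2⟩ := sigma₁_x (K := K) (-1) a c
  obtain ⟨t0, t1, t2⟩ := sigma₂_x (K := K) (-1) (-1) a c
  simp only [sgn_neg_one, one_mul, neg_mul] at s0 t0 t1 t2
  have hX0 := x_ne_zero (K := K) 0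
  have hY0 := x_ne_zero (K := K) 1
  have hZ0 := x_ne_zero (K := K) 2
  have ha := const_ne_zero (K := K) a
  have hc := const_ne_zero (K := K) c
  have hac : (const ((-(a * c) : Kˣ) : K) : RatFun3 K) = -(const (a : K) * const (c : K)) := by
    simp [const]
  have hP0 := plusPart_ne_zero h2' 0 a
  obtain ⟨sP, sQ⟩ := map_parts_neg (a := (a : K)) s0
  obtain ⟨sL, sM⟩ := map_parts_inv ha hY0 s1
  obtain ⟨tP, tQ⟩ := map_parts_inv ha hX0 t0
  obtain ⟨tL, tM⟩ := map_parts_neg (a := (a : K)) t1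
  have hPQ := plusPart_sq h2' (const (a : K)) hX0
  have hLM := plusPart_sq h2' (const (a : K)) hY0
  have hX := plusPart_add_minusPart h2' (const (a : K)) (x 0)
  have hY := plusPart_add_minusPart h2' (const (a : K)) (x 1)
  have hLP : plusPart (const (a : K)) (x 1) + plusPart (const (a : K)) (x 0) ≠ 0 := by
    intro h
    have hp := algebraMap_ne_zero_of_eval (p := (MvPolynomial.X 1 ^ 2 + MvPolynomial.C (a : K)) *
      MvPolynomial.X 0 + (MvPolynomial.X 0 ^ 2 + MvPolynomial.C (a : K)) * MvPolynomial.X 1)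
      ![1, 0, 0] (by simp)
    apply hp
    simp only [map_add, map_mul, map_pow, algebraMap_X, algebraMap_C]
    unfold plusPart at h
    field_simp at h
    linear_combination h
  have hLP' : plusPart (const (a : K)) (x 1) - plusPart (const (a : K)) (x 0) ≠ 0 := by
    intro h
    have hp := algebraMap_ne_zero_of_eval (p := (MvPolynomial.X 1 ^ 2 + MvPolynomial.C (a : K)) *
      MvPolynomial.X 0 - (MvPolynomial.X 0 ^ 2 + MvPolynomial.C (a : K)) * MvPolynomial.X 1)
      ![1, 0, 0] (by simp)
    apply hp
    simp only [map_add, map_sub, map_mul, map_pow, algebraMap_X, algebraMap_C]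
    unfold plusPart at h
    field_simp at h
    linear_combination h
  generalize minusPart (const (a : K)) (x 0) = Q at *
  generalize plusPart (const (a : K)) (x 0) = P at *
  generalize minusPart (const (a : K)) (x 1) = M at *
  generalize plusPart (const (a : K)) (x 1) = L at *
  obtain ⟨y, hy⟩ : ∃ y : RatFun3 K, y = (M * P + Q * L) / (L + P) := ⟨_, rfl⟩
  obtain ⟨y', hy'⟩ : ∃ y' : RatFun3 K, y' = (M * P - Q * L) / (L - P) := ⟨_, rfl⟩
  have hyy : y' * y = const (a : K) := by
    rw [hy, hy', div_mul_div_comm, div_eq_iff (mul_ne_zero hLP' hLP)]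
    linear_combination M ^ 2 * hPQ - Q ^ 2 * hLM - const (a : K) * (hLM - hPQ)
  have hy0 : y ≠ 0 := right_ne_zero_of_mul (hyy ▸ ha)
  have hδ : y - y' - 2 * Q ≠ 0 := by
    intro h
    have e1 : y * (L + P) = M * P + Q * L := by rw [hy]; field_simp
    have e2 : y' * (L - P) = M * P - Q * L := by rw [hy']; field_simp
    have e3 : y + y' = 0 := by
      have : P * (y + y') = 0 := by linear_combination e1 - e2 - L * h
      exact (mul_eq_zero.1 this).resolve_left hP0
    have e4 : y = Q := by
      have : 2 * (y - Q) = 0 := by linear_combination h + e3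
      exact sub_eq_zero.1 ((mul_eq_zero.1 this).resolve_left h2')
    have : P ^ 2 = 0 := by
      rw [hPQ, ← hyy, ← e4]
      linear_combination y * e3
    exact hP0 (pow_eq_zero_iff two_ne_zero |>.1 this)
  have sy : sigma₁ (-1) a c y = y' := by
    rw [hy, hy', map_div₀, map_add, map_add, map_mul, map_mul, sM, sP, sQ, sL]
    ring_nf
  have ty : sigma₂ (-1) (-1) a c y = y' := by
    rw [hy, hy', map_div₀, map_add, map_add, map_mul, map_mul, tM, tP, tQ, tL, ← neg_div_neg_eq]
    ring_nf
  have sy' : sigma₁ (-1) a c y' = y := by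
    rw [hy, hy', map_div₀, map_sub, map_sub, map_mul, map_mul, sM, sP, sQ, sL]
    ring_nf
  refine reducesTo_problemR h2 (g₁ := sigma₁ (-1) a c * sigma₂ (-1) (-1) a c)
    (g₂ := sigma₁ (-1) a c) (fun z => ?_) ![Q, y, x 2 * P] P ?_ ?_ ?_ ?_ hP0 ?_ ?_ ?_
  · rw [mem_noether3311, AlgEquiv.mul_apply]
    refine ⟨fun ⟨h, h'⟩ => ⟨by rw [h', h], h⟩, fun ⟨h, h'⟩ => ⟨h', ?_⟩⟩
    exact (sigma₁ (-1) a c).injective (h.trans h'.symm)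
  · simp [Fin.forall_fin_succ, tQ, sQ, ty, sy', t2, tP, map_const, s2, sP, neg_div,
      div_div_cancel₀ hc]
  · simp [sQ]
  · simp [sy, eq_div_iff hy0, hyy]
  · simp only [Matrix.cons_val, map_mul, s2, sP, hac]
    rw [eq_div_iff (mul_ne_zero hZ0 hP0)]
    field_simp
    linear_combination -hPQ
  · simp [sP, tP]
  · intro E hE
    exact hPQ ▸ E.add_mem (pow_mem (hE 0) 2) (const_mem E _)
  · intro E hE hP
    have hQ : Q ∈ E := hE 0
    have hyE : y ∈ E := hE 1
    have h3 : x 2 * P ∈ E := hE 2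
    have hyE' : y' ∈ E := by
      refine mem_of_mul_mem E hyE hy0 ?_
      rw [mul_comm, hyy]
      exact const_mem E _
    have e1 : y * (L + P) = M * P + Q * L := by rw [hy]; field_simp
    have e2 : y' * (L - P) = M * P - Q * L := by rw [hy']; field_simp
    have hL : L ∈ E := by
      refine mem_of_mul_mem E (E.sub_mem (E.sub_mem hyE hyE')
        (E.mul_mem (ofNat_mem E 2) hQ)) hδ ?_
      have : (y - y' - 2 * Q) * L = -(P * (y + y')) := by linear_combination e1 - e2
      rw [this]
      exact E.neg_mem (E.mul_mem hP (E.add_mem hyE hyE'))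
    have hM : M ∈ E := by
      refine mem_of_mul_mem E hP hP0 ?_
      have : P * M = y * (L + P) - Q * L := by linear_combination -e1
      rw [this]
      exact E.sub_mem (E.mul_mem hyE (E.add_mem hL hP)) (E.mul_mem hQ hL)
    rw [Fin.forall_fin_succ, Fin.forall_fin_two]
    exact ⟨hX ▸ E.add_mem hP hQ, hY ▸ E.add_mem hL hM,
      mem_of_mul_mem E hP hP0 (mul_comm (x 2) P ▸ h3)⟩

lemma reducesTo_neg_swap₁₂ (a b c : Kˣ) :
    ReducesTo (noether3311 (-1) (-1) (-1) a b c) (noether3311 (-1) (-1) (-1) b a (-c)) :=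
  reducesTo_swap₁₂ (by simp)

lemma reducesTo_neg_swap₂₃ (a b c : Kˣ) :
    ReducesTo (noether3311 (-1) (-1) (-1) a b c) (noether3311 (-1) (-1) (-1) (-a) c b) :=
  reducesTo_swap₂₃ (by simp)

theorem reducesTo_problemR_neg_of_isSquare (h2 : (2 : K) ≠ 0) {a b c : Kˣ}
    (h : IsSquare a ∨ IsSquare (-a)) :
    ReducesTo (noether3311 (-1) (-1) (-1) a b c) (problemR b (-1) c) := by
  have key : ∀ a b c : Kˣ, IsSquare a →
      ReducesTo (noether3311 (-1) (-1) (-1) a b c) (problemR b (-1) c) := by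
    rintro _ b c ⟨m, rfl⟩
    exact (reducesTo_scale (a' := 1) m (by rw [one_mul, sq])).trans
      (reducesTo_problemR_neg_of_one h2 b c)
  rcases h with h | h
  · exact key a b c h
  · exact ((reducesTo_neg_swap₂₃ a b c).trans (key (-a) c b h)).trans (problemR_swap₁₃ h2 _ _ _)

theorem reducesTo_problemR_neg_of_isSquare_mul (h2 : (2 : K) ≠ 0) {a b c : Kˣ}
    (h : IsSquare (a * b)) :
    ReducesTo (noether3311 (-1) (-1) (-1) a b c) (problemR a c (-(a * c))) := by
  obtain ⟨m, hm⟩ := h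
  have hb : b = a * (m / a) ^ 2 := by
    rw [div_pow, sq m, ← hm, sq, mul_div_mul_left_eq_div, mul_div_cancel]
  have h1 := (reducesTo_neg_swap₁₂ a b c).trans (reducesTo_scale (m / a) hb)
  have h3 := h1.trans (reducesTo_neg_swap₁₂ a a (-c))
  rw [neg_neg] at h3
  exact h3.trans (reducesTo_problemR_neg_of_eq h2 a c)

theorem reducesTo_problemR_neg_of_isSquare₃ (h2 : (2 : K) ≠ 0) {a b c : Kˣ}
    (h : IsSquare c ∨ IsSquare (-c)) :
    ReducesTo (noether3311 (-1) (-1) (-1) a b c) (problemR a (-1) b) := by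
  have h1 := ((reducesTo_neg_swap₂₃ a b c).trans (reducesTo_neg_swap₁₂ (-a) c b)).trans
    (reducesTo_problemR_neg_of_isSquare h2 h)
  have h3 := (h1.trans (problemR_swap₁₂ h2 _ _ _)).trans (problemR_neg_one_neg _ _)
  rw [neg_neg, neg_neg] at h3
  exact h3.trans (problemR_swap₁₂ h2 _ _ _)

section norms

variable {k : Type*} [Field k] {σ : Type*}

/-- Polynomials over `k(√α)` are a quadratic algebra over the polynomials over `k`. -/
def quadraticToMvPolynomial (σ : Type*) (α : k) :
    QuadraticAlgebra (MvPolynomial σ k) (MvPolynomial.C α) 0 →+*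
      MvPolynomial σ (QuadraticAlgebra k α 0) where
  toFun z := MvPolynomial.map (algebraMap k _) z.re +
    MvPolynomial.C QuadraticAlgebra.omega * MvPolynomial.map (algebraMap k _) z.im
  map_one' := by simp [QuadraticAlgebra.re_one, QuadraticAlgebra.im_one]
  map_zero' := by simp
  map_add' z w := by simp only [QuadraticAlgebra.re_add, QuadraticAlgebra.im_add, map_add]; ring
  map_mul' z w := by
    have h : (MvPolynomial.C (QuadraticAlgebra.omega : QuadraticAlgebra k α 0) *
        MvPolynomial.C QuadraticAlgebra.omega : MvPolynomial σ (QuadraticAlgebra k α 0)) =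
        MvPolynomial.C (algebraMap k _ α) := by
      rw [← map_mul]
      congr 1
      ext <;> simp
    simp only [QuadraticAlgebra.re_mul, QuadraticAlgebra.im_mul, map_add, map_mul, map_zero,
      MvPolynomial.map_C]
    linear_combination -(MvPolynomial.map (algebraMap k (QuadraticAlgebra k α 0)) z.im) *
      (MvPolynomial.map (algebraMap k (QuadraticAlgebra k α 0)) w.im) * h

lemma quadraticToMvPolynomial_bijective (α : k) :
    Function.Bijective (quadraticToMvPolynomial σ α) := by
  constructor
  · rw [injective_iff_map_eq_zero]
    intro z hz
    have hc : ∀ m, (algebraMap k (QuadraticAlgebra k α 0) (z.re.coeff m)) +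
        QuadraticAlgebra.omega * algebraMap k (QuadraticAlgebra k α 0) (z.im.coeff m) = 0 := by
      intro m
      have := congrArg (MvPolynomial.coeff m) hz
      simpa [quadraticToMvPolynomial, MvPolynomial.coeff_C_mul, MvPolynomial.coeff_map] using this
    ext m
    · have := congrArg QuadraticAlgebra.re (hc m)
      simpa using this
    · have := congrArg QuadraticAlgebra.im (hc m)
      simpa using this
  · intro p
    induction p using MvPolynomial.induction_on with
    | C z =>
      refine ⟨⟨MvPolynomial.C z.re, MvPolynomial.C z.im⟩, ?_⟩
      simp only [quadraticToMvPolynomial, RingHom.coe_mk, MonoidHom.coe_mk, OneHom.coe_mk,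
        MvPolynomial.map_C, ← map_mul, ← map_add]
      congr 1
      ext <;> simp
    | add p q hp hq =>
      obtain ⟨z, rfl⟩ := hp
      obtain ⟨w, rfl⟩ := hq
      exact ⟨z + w, map_add _ _ _⟩
    | mul_X p i hp =>
      obtain ⟨z, rfl⟩ := hp
      exact ⟨z * ⟨MvPolynomial.X i, 0⟩, by simp [quadraticToMvPolynomial]; ring⟩

/-- A prime of `k[t]` that divides a norm from `k(√α)[t]` nontrivially is a norm, up to units. -/
lemma exists_norm_eq_of_dvd {α : k} (hα : ¬ IsSquare α) {π X Y : MvPolynomial σ k} (hπ : Prime π)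
    (h : π ∣ X ^ 2 - MvPolynomial.C α * Y ^ 2) (hXY : ¬ (π ∣ X ∧ π ∣ Y)) :
    ∃ u : k, u ≠ 0 ∧ ∃ P Q : MvPolynomial σ k,
      MvPolynomial.C u * π = P ^ 2 - MvPolynomial.C α * Q ^ 2 := by
  have : Fact (∀ r : k, r ^ 2 ≠ α + 0 * r) :=
    ⟨fun r hr => hα ⟨r, by rw [← sq, hr]; ring⟩⟩
  let e : QuadraticAlgebra (MvPolynomial σ k) (MvPolynomial.C α) 0 ≃+* MvPolynomial σ (QuadraticAlgebra k α 0) :=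
    RingEquiv.ofBijective _ (quadraticToMvPolynomial_bijective α)
  have : IsDomain (QuadraticAlgebra (MvPolynomial σ k) (MvPolynomial.C α) 0) := e.toMulEquiv.isDomain _
  have : UniqueFactorizationMonoid
      (QuadraticAlgebra (MvPolynomial σ k) (MvPolynomial.C α) 0) :=
    e.symm.toMulEquiv.uniqueFactorizationMonoid inferInstance
  let ι : MvPolynomial σ k →+* QuadraticAlgebra (MvPolynomial σ k) (MvPolynomial.C α) 0 := algebraMap _ _
  have hιre : ∀ p, (ι p).re = p := fun p => rfl
  have hιim : ∀ p : MvPolynomial σ k, (ι p).im = 0 := fun p => rfl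
  have hdvd : ∀ z : QuadraticAlgebra (MvPolynomial σ k) (MvPolynomial.C α) 0, ι π ∣ z → π ∣ z.re ∧ π ∣ z.im := by
    rintro _ ⟨w, rfl⟩
    rw [QuadraticAlgebra.re_mul, QuadraticAlgebra.im_mul, hιre, hιim]
    exact ⟨⟨w.re, by ring⟩, ⟨w.im, by ring⟩⟩
  have hnp : ¬ Prime (ι π) := by
    intro hp
    have h1 : ι π ∣ (⟨X, Y⟩ : QuadraticAlgebra (MvPolynomial σ k) (MvPolynomial.C α) 0) *
        ⟨X, -Y⟩ := by
      have h2 : (⟨X, Y⟩ : QuadraticAlgebra (MvPolynomial σ k) (MvPolynomial.C α) 0) * ⟨X, -Y⟩ =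
          ι (X ^ 2 - MvPolynomial.C α * Y ^ 2) := by
        refine QuadraticAlgebra.ext ?_ ?_
        · rw [hιre, QuadraticAlgebra.re_mul]; ring
        · rw [hιim, QuadraticAlgebra.im_mul]; ring
      rw [h2]
      exact map_dvd ι h
    rcases hp.dvd_or_dvd h1 with h2 | h2
    · exact hXY (hdvd _ h2)
    · exact hXY ⟨(hdvd _ h2).1, (dvd_neg).1 (hdvd _ h2).2⟩
  have hnorm : QuadraticAlgebra.norm (ι π) = π ^ 2 := QuadraticAlgebra.norm_algebraMap π
  have hnu : ¬ IsUnit (ι π) := by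
    rw [QuadraticAlgebra.isUnit_iff_norm_isUnit, hnorm]
    intro hu
    exact hπ.not_isUnit (isUnit_pow_iff two_ne_zero |>.1 hu)
  have hni : ¬ Irreducible (ι π) := fun hi =>
    hnp (UniqueFactorizationMonoid.irreducible_iff_prime.1 hi)
  rw [irreducible_iff] at hni
  push Not at hni
  obtain ⟨g, g', hg, hgu, hgu'⟩ := hni hnu
  rw [QuadraticAlgebra.isUnit_iff_norm_isUnit] at hgu hgu'
  have hgg : QuadraticAlgebra.norm g * QuadraticAlgebra.norm g' = π ^ 2 := by
    rw [← hnorm, hg, map_mul]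
  have hass : Associated (QuadraticAlgebra.norm g) π := by
    have hd : QuadraticAlgebra.norm g ∣ π ^ 2 := ⟨_, hgg.symm⟩
    obtain ⟨i, hi, hass⟩ := (dvd_prime_pow hπ 2).1 hd
    interval_cases i
    · exact absurd (associated_one_iff_isUnit.1 (by simpa using hass)) hgu
    · simpa using hass
    · exfalso
      apply hgu'
      obtain ⟨u, hu⟩ := hass
      rw [← hu] at hgg
      have h0 : QuadraticAlgebra.norm g ≠ 0 := by
        intro h0
        rw [h0, zero_mul] at hu
        exact pow_ne_zero 2 hπ.ne_zero hu.symm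
      exact mul_left_cancel₀ h0 hgg ▸ u.isUnit
  obtain ⟨u, hu⟩ := hass.symm
  obtain ⟨r, hr, hru⟩ := MvPolynomial.isUnit_iff_eq_C_of_isReduced.1 u.isUnit
  refine ⟨r, hr.ne_zero, g.re, g.im, ?_⟩
  rw [← hru, mul_comm, hu, QuadraticAlgebra.norm_def]
  ring

/-- Projective coordinates in `k(t)` have representatives in `k[t]` that are not all divisible by
a given prime. -/
lemma exists_coordinates {π : MvPolynomial σ k} (hπ : Prime π) {G : Type*} [Field G]
    [Algebra (MvPolynomial σ k) G] [IsFractionRing (MvPolynomial σ k) G] (X U V : G)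
    (h0 : ¬ (X = 0 ∧ U = 0 ∧ V = 0)) :
    ∃ d : G, d ≠ 0 ∧ ∃ X' U' V' : MvPolynomial σ k, algebraMap _ G X' = d * X ∧
      algebraMap _ G U' = d * U ∧ algebraMap _ G V' = d * V ∧ ¬ (π ∣ X' ∧ π ∣ U' ∧ π ∣ V') := by
  have hinj := IsFractionRing.injective (MvPolynomial σ k) G
  have key : ∀ (n : ℕ) (X' U' V' : MvPolynomial σ k), ¬ (π ^ n ∣ X' ∧ π ^ n ∣ U' ∧ π ^ n ∣ V') →
      ∀ d : G, d ≠ 0 → algebraMap _ G X' = d * X → algebraMap _ G U' = d * U →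
      algebraMap _ G V' = d * V → ∃ d : G, d ≠ 0 ∧ ∃ X' U' V' : MvPolynomial σ k,
        algebraMap _ G X' = d * X ∧ algebraMap _ G U' = d * U ∧ algebraMap _ G V' = d * V ∧
        ¬ (π ∣ X' ∧ π ∣ U' ∧ π ∣ V') := by
    intro n
    induction n with
    | zero => intro X' U' V' h; simp at h
    | succ n ih =>
      intro X' U' V' h d hd hX hU hV
      by_cases hdiv : π ∣ X' ∧ π ∣ U' ∧ π ∣ V'
      · obtain ⟨⟨X', rfl⟩, ⟨U', rfl⟩, ⟨V', rfl⟩⟩ := hdiv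
        have hπ0 : algebraMap _ G π ≠ 0 := (map_ne_zero_iff _ hinj).2 hπ.ne_zero
        rw [map_mul] at hX hU hV
        refine ih X' U' V' ?_ (d / algebraMap _ G π) (div_ne_zero hd hπ0) ?_ ?_ ?_
        · simpa only [pow_succ', mul_dvd_mul_iff_left hπ.ne_zero] using h
        · rw [div_mul_eq_mul_div, ← hX, mul_div_cancel_left₀ _ hπ0]
        · rw [div_mul_eq_mul_div, ← hU, mul_div_cancel_left₀ _ hπ0]
        · rw [div_mul_eq_mul_div, ← hV, mul_div_cancel_left₀ _ hπ0]
      · exact ⟨d, hd, X', U', V', hX, hU, hV, hdiv⟩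
  classical
  obtain ⟨b, hb⟩ := IsLocalization.exist_integer_multiples_of_finset
    (nonZeroDivisors (MvPolynomial σ k)) ({X, U, V} : Finset G)
  obtain ⟨X', hX⟩ := hb X (by simp)
  obtain ⟨U', hU⟩ := hb U (by simp)
  obtain ⟨V', hV⟩ := hb V (by simp)
  rw [Algebra.smul_def] at hX hU hV
  have hd : algebraMap _ G (b : MvPolynomial σ k) ≠ 0 :=
    (map_ne_zero_iff _ hinj).2 (nonZeroDivisors.ne_zero b.2)
  have hne : ¬ (X' = 0 ∧ U' = 0 ∧ V' = 0) := by
    rintro ⟨rfl, rfl, rfl⟩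
    simp only [map_zero, zero_eq_mul, hd, false_or] at hX hU hV
    exact h0 ⟨hX, hU, hV⟩
  have hfin : ∃ n : ℕ, ¬ (π ^ n ∣ X' ∧ π ^ n ∣ U' ∧ π ^ n ∣ V') := by
    have hf : ∀ W : MvPolynomial σ k, W ≠ 0 → ∃ n : ℕ, ¬ π ^ n ∣ W := fun W hW =>
      let ⟨n, hn⟩ := FiniteMultiplicity.of_prime_left hπ hW
      ⟨n + 1, hn⟩
    by_cases hX0 : X' = 0
    · by_cases hU0 : U' = 0
      · obtain ⟨n, hn⟩ := hf V' fun hV0 => hne ⟨hX0, hU0, hV0⟩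
        exact ⟨n, fun h => hn h.2.2⟩
      · obtain ⟨n, hn⟩ := hf U' hU0
        exact ⟨n, fun h => hn h.2.1⟩
    · obtain ⟨n, hn⟩ := hf X' hX0
      exact ⟨n, fun h => hn h.1⟩
  obtain ⟨n, hn⟩ := hfin
  exact key n X' U' V' hn _ hd hX hU hV

variable {F : Type*} [Field F] [Algebra k F]

/-- `f` is a norm from `F(√α)`, up to a constant factor. -/
def IsScaledNorm (α : k) (f : F) : Prop :=
  ∃ u : k, u ≠ 0 ∧ ∃ X Y : F, algebraMap k F u * f = X ^ 2 - algebraMap k F α * Y ^ 2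

lemma IsScaledNorm.mul {α : k} {f g : F} (hf : IsScaledNorm α f) (hg : IsScaledNorm α g) :
    IsScaledNorm α (f * g) := by
  obtain ⟨u, hu, X, Y, h⟩ := hf
  obtain ⟨u', hu', X', Y', h'⟩ := hg
  refine ⟨u * u', mul_ne_zero hu hu', X * X' + algebraMap k F α * Y * Y', X * Y' + Y * X', ?_⟩
  rw [map_mul, mul_mul_mul_comm, h, h']
  ring

lemma isScaledNorm_const {α : k} {u : k} (hu : u ≠ 0) : IsScaledNorm α (algebraMap k F u) :=
  ⟨u⁻¹, inv_ne_zero hu, 1, 0, by rw [← map_mul, inv_mul_cancel₀ hu]; simp⟩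

lemma isScaledNorm_sq (α : k) (f : F) : IsScaledNorm α (f ^ 2) :=
  ⟨1, one_ne_zero, f, 0, by simp⟩

lemma isScaledNorm_of_mul_sq {α : k} {f g : F} (hg : g ≠ 0) (h : IsScaledNorm α (f * g ^ 2)) :
    IsScaledNorm α f := by
  have := h.mul (isScaledNorm_sq α g⁻¹)
  rwa [mul_assoc, ← mul_pow, mul_inv_cancel₀ hg, one_pow, mul_one] at this

variable [Algebra (MvPolynomial σ k) F] [IsScalarTower k (MvPolynomial σ k) F]

lemma isScaledNorm_algebraMap {α : k} (A : MvPolynomial σ k) (hA : A ≠ 0)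
    (h : ∀ π, Prime π → IsScaledNorm α (algebraMap _ F π) ∨
      ∀ n, π ^ n ∣ A → ¬ π ^ (n + 1) ∣ A → Even n) :
    IsScaledNorm α (algebraMap _ F A) := by
  induction A using UniqueFactorizationMonoid.induction_on_coprime with
  | h0 => exact absurd rfl hA
  | h1 hu =>
    obtain ⟨r, hr, rfl⟩ := MvPolynomial.isUnit_iff_eq_C_of_isReduced.1 hu
    have : algebraMap (MvPolynomial σ k) F (MvPolynomial.C r) = algebraMap k F r :=
      (IsScalarTower.algebraMap_apply k (MvPolynomial σ k) F r).symm
    rw [this]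
    exact isScaledNorm_const hr.ne_zero
  | @hpr p i hp =>
    rcases h p hp with h' | h'
    · rw [map_pow]
      clear h hA
      induction i with
      | zero => simpa using isScaledNorm_sq α (1 : F)
      | succ i ih => rw [pow_succ]; exact ih.mul h'
    · obtain ⟨m, rfl⟩ := h' i dvd_rfl fun hd => by
        have := (pow_dvd_pow_iff hp.ne_zero hp.not_isUnit).1 hd
        omega
      rw [← two_mul, mul_comm, pow_mul, map_pow]
      exact isScaledNorm_sq α _
  | @hcp x y hxy hx hy =>
    have hx0 := left_ne_zero_of_mul hA
    have hy0 := right_ne_zero_of_mul hA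
    have aux : ∀ x y : MvPolynomial σ k, IsRelPrime x y → ∀ π, Prime π →
        (∀ n, π ^ n ∣ x * y → ¬ π ^ (n + 1) ∣ x * y → Even n) →
        ∀ n, π ^ n ∣ x → ¬ π ^ (n + 1) ∣ x → Even n := by
      intro x y hxy π hπ h n hn hn'
      rcases Nat.eq_zero_or_pos n with rfl | hpos
      · exact Even.zero
      have hπx : π ∣ x := (dvd_pow_self π hpos.ne').trans hn
      refine h n (hn.mul_right y) fun hd => hn' ?_
      exact hπ.pow_dvd_of_dvd_mul_right _ (fun hπy => hπ.not_isUnit (hxy hπx hπy)) hd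
    rw [map_mul]
    refine (hx hx0 fun π hπ => (h π hπ).imp_right (aux x y hxy π hπ)).mul
      (hy hy0 fun π hπ => (h π hπ).imp_right ?_)
    rw [mul_comm x y]
    exact aux y x hxy.symm π hπ

/-- The exact power of an inert prime in a norm is even. -/
lemma even_of_pow_dvd_norm {α : k} {π : MvPolynomial σ k} (hπ : Prime π)
    (hin : ∀ X Y, π ∣ X ^ 2 - MvPolynomial.C α * Y ^ 2 → π ∣ X ∧ π ∣ Y) (n : ℕ) :
    ∀ X Y, π ^ n ∣ X ^ 2 - MvPolynomial.C α * Y ^ 2 →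
      ¬ π ^ (n + 1) ∣ X ^ 2 - MvPolynomial.C α * Y ^ 2 → Even n := by
  induction n using Nat.strong_induction_on with
  | _ n ih =>
    intro X Y h h'
    rcases Nat.eq_zero_or_pos n with rfl | hpos
    · exact Even.zero
    obtain ⟨⟨X, rfl⟩, ⟨Y, rfl⟩⟩ := hin X Y ((dvd_pow_self π hpos.ne').trans h)
    have e : (π * X) ^ 2 - MvPolynomial.C α * (π * Y) ^ 2 =
        π ^ 2 * (X ^ 2 - MvPolynomial.C α * Y ^ 2) := by ring
    rw [e] at h h'
    obtain ⟨m, rfl⟩ : ∃ m, n = m + 2 := by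
      refine ⟨n - 2, ?_⟩
      by_contra hn
      obtain rfl : n = 1 := by omega
      exact h' (dvd_mul_right _ _)
    rw [pow_add, mul_comm, mul_dvd_mul_iff_left (pow_ne_zero 2 hπ.ne_zero)] at h
    rw [add_right_comm, pow_add _ (m + 1), mul_comm,
      mul_dvd_mul_iff_left (pow_ne_zero 2 hπ.ne_zero)] at h'
    exact (ih m (by omega) X Y h h').add even_two

/-- The exact power of an inert prime in the numerator `A` is even if a certain conic has a point. -/
lemma even_of_conic {α : k} {π : MvPolynomial σ k} (hπ : Prime π)
    (hin : ∀ X Y, π ∣ X ^ 2 - MvPolynomial.C α * Y ^ 2 → π ∣ X ∧ π ∣ Y)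
    {A B X U V : MvPolynomial σ k} (hAB : IsRelPrime A B) {e p q : k} (he : e ≠ 0) (hq : q ≠ 0)
    (hXUV : ¬ (π ∣ X ∧ π ∣ U ∧ π ∣ V))
    (h : B * (X ^ 2 - MvPolynomial.C α * (MvPolynomial.C e * U) ^ 2) =
      A * (MvPolynomial.C p * U ^ 2 + MvPolynomial.C q * V ^ 2)) {n : ℕ} (hn : π ^ n ∣ A)
    (hn' : ¬ π ^ (n + 1) ∣ A) : Even n := by
  rcases Nat.eq_zero_or_pos n with rfl | hpos
  · exact Even.zero
  have hC : ∀ {u : k} {W : MvPolynomial σ k}, u ≠ 0 → π ∣ MvPolynomial.C u * W → π ∣ W := by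
    intro u W hu hd
    have : IsUnit (MvPolynomial.C u : MvPolynomial σ k) := (isUnit_iff_ne_zero.2 hu).map _
    exact (this.dvd_mul_left).1 hd
  have hπA : π ∣ A := (dvd_pow_self π hpos.ne').trans hn
  have hπB : ¬ π ∣ B := fun hB => hπ.not_isUnit (hAB hπA hB)
  have hπN : π ∣ X ^ 2 - MvPolynomial.C α * (MvPolynomial.C e * U) ^ 2 :=
    (hπ.dvd_or_dvd (by rw [h]; exact hπA.mul_right _)).resolve_left hπB
  obtain ⟨hX, hU⟩ := hin _ _ hπN
  have hU' := hC he hU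
  have hM : ¬ π ∣ MvPolynomial.C p * U ^ 2 + MvPolynomial.C q * V ^ 2 := by
    intro hM
    have := (dvd_add_right ((dvd_pow hU' two_ne_zero).mul_left (MvPolynomial.C p))).1 hM
    exact hXUV ⟨hX, hU', hπ.dvd_of_dvd_pow (hC hq this)⟩
  refine even_of_pow_dvd_norm hπ hin n X (MvPolynomial.C e * U) ?_ fun hd => hn' ?_
  · exact hπ.pow_dvd_of_dvd_mul_left n hπB (by rw [h]; exact hn.mul_right _)
  · exact hπ.pow_dvd_of_dvd_mul_right (n + 1) hM (by rw [← h]; exact hd.mul_left B)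

variable [IsFractionRing (MvPolynomial σ k) F]

/-- If the conic `X² - α (eU)² = (A / B) (p U² + q V²)` has a point over `k(t)`, then the
numerator `A` is a norm from `k(√α)(t)` up to a constant. -/
lemma isScaledNorm_of_conic {α : k} (hα : ¬ IsSquare α) {A B : MvPolynomial σ k}
    (hAB : IsRelPrime A B) (hA : A ≠ 0) (hB : B ≠ 0) {e p q : k} (he : e ≠ 0) (hq : q ≠ 0)
    {X U V : F} (h0 : ¬ (X = 0 ∧ U = 0 ∧ V = 0))
    (h : X ^ 2 - algebraMap k F α * (algebraMap k F e * U) ^ 2 =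
      algebraMap _ F A / algebraMap _ F B * (algebraMap k F p * U ^ 2 + algebraMap k F q * V ^ 2)) :
    IsScaledNorm α (algebraMap _ F A) := by
  have hinj := IsFractionRing.injective (MvPolynomial σ k) F
  have hC : ∀ r : k, algebraMap (MvPolynomial σ k) F (MvPolynomial.C r) = algebraMap k F r :=
    fun r => (IsScalarTower.algebraMap_apply k (MvPolynomial σ k) F r).symm
  refine isScaledNorm_algebraMap A hA fun π hπ => ?_
  by_cases hin : ∀ X Y, π ∣ X ^ 2 - MvPolynomial.C α * Y ^ 2 → π ∣ X ∧ π ∣ Y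
  · right
    obtain ⟨d, -, X', U', V', hX, hU, hV, hXUV⟩ := exists_coordinates hπ X U V h0
    intro n
    refine even_of_conic (p := p) hπ hin hAB he hq hXUV (hinj ?_)
    have hB' : algebraMap _ F B ≠ 0 := (map_ne_zero_iff _ hinj).2 hB
    simp only [map_mul, map_sub, map_add, map_pow, hC, hX, hU, hV]
    field_simp at h
    linear_combination d ^ 2 * h
  · left
    push Not at hin
    obtain ⟨X, Y, hXY, hn⟩ := hin
    obtain ⟨u, hu, P, Q, hPQ⟩ := exists_norm_eq_of_dvd hα hπ hXY fun h => hn h.1 h.2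
    refine ⟨u, hu, algebraMap _ F P, algebraMap _ F Q, ?_⟩
    rw [← hC, ← hC, ← map_mul, hPQ]
    simp

end norms

theorem isScaledNorm_mul_of_conics {k F : Type*} [Field k] [Field F] [Algebra k F] (σ : Type*)
    [Algebra (MvPolynomial σ k) F] [IsScalarTower k (MvPolynomial σ k) F]
    [IsFractionRing (MvPolynomial σ k) F] {α : k} (hα : ¬ IsSquare α) {δ : k} {S T : F}
    (hS : S ≠ 0) (hT : T ≠ 0) (hST : T = S - algebraMap k F δ)
    {e p q e' p' q' : k} (he : e ≠ 0) (hq : q ≠ 0) (he' : e' ≠ 0) (hq' : q' ≠ 0)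
    {X U V X' U' V' : F} (h0 : ¬ (X = 0 ∧ U = 0 ∧ V = 0)) (h0' : ¬ (X' = 0 ∧ U' = 0 ∧ V' = 0))
    (h : X ^ 2 - algebraMap k F α * (algebraMap k F e * U) ^ 2 =
      S * (algebraMap k F p * U ^ 2 + algebraMap k F q * V ^ 2))
    (h' : X' ^ 2 - algebraMap k F α * (algebraMap k F e' * U') ^ 2 =
      T * (algebraMap k F p' * U' ^ 2 + algebraMap k F q' * V' ^ 2)) :
    IsScaledNorm α (S * T) := by
  have hinj := IsFractionRing.injective (MvPolynomial σ k) F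
  obtain ⟨A, ⟨B, hBm⟩, hAB, rfl⟩ := IsFractionRing.exists_reduced_fraction (MvPolynomial σ k) S
  have hB : B ≠ 0 := nonZeroDivisors.ne_zero hBm
  have hB' : algebraMap _ F B ≠ 0 := (map_ne_zero_iff _ hinj).2 hB
  simp only [IsFractionRing.mk'_eq_div] at *
  have hC : algebraMap (MvPolynomial σ k) F (MvPolynomial.C δ) = algebraMap k F δ :=
    (IsScalarTower.algebraMap_apply k (MvPolynomial σ k) F δ).symm
  have hT' : T = algebraMap _ F (A - MvPolynomial.C δ * B) / algebraMap _ F B := by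
    rw [hST, map_sub, map_mul, hC]
    field_simp
  have hA : A ≠ 0 := by rintro rfl; simp at hS
  have hA' : A - MvPolynomial.C δ * B ≠ 0 := by intro h0; rw [h0] at hT'; simp [hT'] at hT
  have hAB' : IsRelPrime (A - MvPolynomial.C δ * B) B := by
    intro d hd hdB
    refine hAB ?_ hdB
    have := dvd_add hd (hdB.mul_left (MvPolynomial.C δ))
    rwa [sub_add_cancel] at this
  have h1 := isScaledNorm_of_conic hα hAB hA hB he hq h0 h
  rw [hT'] at h'
  have h3 := isScaledNorm_of_conic hα hAB' hA' hB he' hq' h0' h'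
  refine isScaledNorm_of_mul_sq hB' ?_
  rw [hT']
  convert h1.mul h3 using 1
  field_simp

section baseChange

variable {k k' : Type*} [Field k] [Field k']

/-- The extension of a homomorphism of fields to rational functions. -/
def baseChange (j : k →+* k') : RatFun3 k →+* RatFun3 k' :=
  IsFractionRing.map (A := MvPolynomial (Fin 3) k) (B := MvPolynomial (Fin 3) k')
    (MvPolynomial.map_injective j j.injective)

lemma baseChange_algebraMap (j : k →+* k') (p : MvPolynomial (Fin 3) k) :
    baseChange j (algebraMap _ _ p) = algebraMap _ (RatFun3 k') (MvPolynomial.map j p) :=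
  IsLocalization.map_eq (nonZeroDivisors_le_comap_nonZeroDivisors_of_injective _
    (MvPolynomial.map_injective j j.injective)) p

@[simp]
lemma baseChange_x (j : k →+* k') (i : Fin 3) : baseChange j (x i) = x i := by
  rw [x, baseChange_algebraMap, MvPolynomial.map_X, x]

@[simp]
lemma baseChange_const (j : k →+* k') (a : k) : baseChange j (const a) = const (j a) := by
  rw [← algebraMap_C, baseChange_algebraMap, MvPolynomial.map_C, algebraMap_C]

lemma baseChange_sgn (j : k →+* k') (ε : ℤˣ) : baseChange j (sgn k ε) = sgn k' ε := by
  simp [sgn]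

lemma baseChange_intertwine (j : k →+* k') {g : RatFun3 k ≃ₐ[k] RatFun3 k}
    {g' : RatFun3 k' ≃ₐ[k'] RatFun3 k'} (h : ∀ i, baseChange j (g (x i)) = g' (x i))
    (z : RatFun3 k) : baseChange j (g z) = g' (baseChange j z) := by
  have : (baseChange j).comp (g : RatFun3 k →+* RatFun3 k) =
      (g' : RatFun3 k' →+* RatFun3 k').comp (baseChange j) :=
    ringHom_ext (fun a => by simp [map_const]) fun i => by simp [h]
  exact DFunLike.congr_fun this z

lemma baseChange_sigma₁ (j : k →+* k') (ε₁ : ℤˣ) {b c : kˣ} {b' c' : k'ˣ} (hb : (b' : k') = j b)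
    (hc : (c' : k') = j c) (z : RatFun3 k) :
    baseChange j (sigma₁ ε₁ b c z) = sigma₁ ε₁ b' c' (baseChange j z) := by
  refine baseChange_intertwine j (fun i => ?_) z
  obtain ⟨s0, s1, s2⟩ := sigma₁_x (K := k) ε₁ b c
  obtain ⟨t0, t1, t2⟩ := sigma₁_x (K := k') ε₁ b' c'
  fin_cases i
  · simp [s0, t0, baseChange_sgn]
  · simp [s1, t1, hb]
  · simp [s2, t2, hc]

lemma baseChange_sigma₂ (j : k →+* k') (ε₂ ε₃ : ℤˣ) {a c : kˣ} {a' c' : k'ˣ}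
    (ha : (a' : k') = j a) (hc : (c' : k') = j c) (z : RatFun3 k) :
    baseChange j (sigma₂ ε₂ ε₃ a c z) = sigma₂ ε₂ ε₃ a' c' (baseChange j z) := by
  refine baseChange_intertwine j (fun i => ?_) z
  obtain ⟨s0, s1, s2⟩ := sigma₂_x (K := k) ε₂ ε₃ a c
  obtain ⟨t0, t1, t2⟩ := sigma₂_x (K := k') ε₂ ε₃ a' c'
  fin_cases i
  · simp [s0, t0, ha]
  · simp [s1, t1, baseChange_sgn]
  · simp [s2, t2, baseChange_sgn, hc]

end baseChange

section laurent

variable {L : Type*} [Field L]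

/-- The ring of Laurent polynomials in `x₁, x₂, x₃`. -/
def laurent (L : Type*) [Field L] : Subalgebra L (RatFun3 L) :=
  Algebra.adjoin L (Set.range x ∪ Set.range fun i => (x i)⁻¹)

lemma x_mem_laurent (i : Fin 3) : x i ∈ laurent L := Algebra.subset_adjoin (by simp)

lemma x_inv_mem_laurent (i : Fin 3) : (x i)⁻¹ ∈ laurent L := Algebra.subset_adjoin (by simp)

lemma const_mem_laurent (a : L) : const a ∈ laurent L := (laurent L).algebraMap_mem a

lemma algebraMap_mem_laurent (p : MvPolynomial (Fin 3) L) :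
    algebraMap _ (RatFun3 L) p ∈ laurent L := by
  induction p using MvPolynomial.induction_on with
  | C a => exact const_mem_laurent a
  | add p q hp hq => rw [map_add]; exact add_mem hp hq
  | mul_X p i hp => rw [map_mul]; exact mul_mem hp (x_mem_laurent i)

lemma exists_mul_pow_of_mem_laurent {z : RatFun3 L} (hz : z ∈ laurent L) :
    ∃ (N : ℕ) (p : MvPolynomial (Fin 3) L),
      z * (x 0 * x 1 * x 2) ^ N = algebraMap _ (RatFun3 L) p := by
  have hx : (algebraMap (MvPolynomial (Fin 3) L) (RatFun3 L) (MvPolynomial.X 0 * MvPolynomial.X 1 * MvPolynomial.X 2)) =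
      x 0 * x 1 * x 2 := by simp [algebraMap_X]
  have h0 := x_ne_zero (K := L) 0
  have h1 := x_ne_zero (K := L) 1
  have h2 := x_ne_zero (K := L) 2
  induction hz using Algebra.adjoin_induction with
  | mem z hz =>
    rcases hz with ⟨i, rfl⟩ | ⟨i, rfl⟩
    · exact ⟨0, MvPolynomial.X i, by simp [algebraMap_X]⟩
    · fin_cases i
      · exact ⟨1, MvPolynomial.X 1 * MvPolynomial.X 2, by simp [algebraMap_X]; field_simp⟩
      · exact ⟨1, MvPolynomial.X 0 * MvPolynomial.X 2, by simp [algebraMap_X]; field_simp⟩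
      · exact ⟨1, MvPolynomial.X 0 * MvPolynomial.X 1, by simp [algebraMap_X]; field_simp⟩
  | algebraMap r => exact ⟨0, MvPolynomial.C r, by rw [algebraMap_C, pow_zero, mul_one]; rfl⟩
  | add z w _ _ hz hw =>
    obtain ⟨N, p, hp⟩ := hz
    obtain ⟨M, q, hq⟩ := hw
    refine ⟨N + M, p * (MvPolynomial.X 0 * MvPolynomial.X 1 * MvPolynomial.X 2) ^ M +
      q * (MvPolynomial.X 0 * MvPolynomial.X 1 * MvPolynomial.X 2) ^ N, ?_⟩
    rw [map_add, map_mul, map_mul, map_pow, map_pow, hx, ← hp, ← hq]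
    ring
  | mul z w _ _ hz hw =>
    obtain ⟨N, p, hp⟩ := hz
    obtain ⟨M, q, hq⟩ := hw
    refine ⟨N + M, p * q, ?_⟩
    rw [map_mul, ← hp, ← hq]
    ring

lemma map_mem_laurent {g : RatFun3 L ≃ₐ[L] RatFun3 L}
    (hg : ∀ i, g (x i) ∈ laurent L ∧ (g (x i))⁻¹ ∈ laurent L) {z : RatFun3 L}
    (hz : z ∈ laurent L) : g z ∈ laurent L := by
  have : laurent L ≤ (laurent L).comap g.toAlgHom := by
    refine Algebra.adjoin_le ?_
    rintro _ (⟨i, rfl⟩ | ⟨i, rfl⟩)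
    · exact (hg i).1
    · change g (x i)⁻¹ ∈ laurent L
      rw [map_inv₀]
      exact (hg i).2
  exact this hz

lemma algebraMap_monomial (m : Fin 3 →₀ ℕ) (r : L) :
    algebraMap _ (RatFun3 L) (MvPolynomial.monomial m r) =
      const r * (x 0 ^ m 0 * x 1 ^ m 1 * x 2 ^ m 2) := by
  rw [MvPolynomial.monomial_eq, Finsupp.prod_fintype _ _ (by simp), Fin.prod_univ_three]
  simp [algebraMap_X, algebraMap_C]

/-- The units of the Laurent polynomial ring are the monomials. -/
lemma eq_monomial_of_mul_eq_one {v w : RatFun3 L} (hv : v ∈ laurent L) (hw : w ∈ laurent L)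
    (h : v * w = 1) :
    ∃ r : L, r ≠ 0 ∧ ∃ n₀ n₁ n₂ : ℤ, v = const r * (x 0 ^ n₀ * x 1 ^ n₁ * x 2 ^ n₂) := by
  obtain ⟨N, p, hp⟩ := exists_mul_pow_of_mem_laurent hv
  obtain ⟨M, q, hq⟩ := exists_mul_pow_of_mem_laurent hw
  have h0 := x_ne_zero (K := L) 0
  have h1 := x_ne_zero (K := L) 1
  have h2 := x_ne_zero (K := L) 2
  let m : Fin 3 →₀ ℕ := Finsupp.equivFunOnFinite.symm fun _ => N + M
  have hpq : p * q = MvPolynomial.monomial m 1 := by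
    apply IsFractionRing.injective (MvPolynomial (Fin 3) L) (RatFun3 L)
    rw [map_mul, ← hp, ← hq, algebraMap_monomial]
    simp only [m, Finsupp.equivFunOnFinite_symm_apply_apply, const, map_one]
    linear_combination (x 0 * x 1 * x 2) ^ (N + M) * h
  obtain ⟨n, r, hn, hr, rfl⟩ := (MvPolynomial.dvd_monomial_one_iff_exists).1 ⟨q, hpq.symm⟩
  refine ⟨r, hr.ne_zero, (n 0 : ℤ) - N, (n 1 : ℤ) - N, (n 2 : ℤ) - N, ?_⟩
  rw [algebraMap_monomial] at hp
  rw [← mul_left_inj' (pow_ne_zero N (mul_ne_zero (mul_ne_zero h0 h1) h2)), hp]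
  simp only [zpow_sub₀ h0, zpow_sub₀ h1, zpow_sub₀ h2, zpow_natCast]
  field_simp
  ring

lemma monomial_eq_one {r : L} {n₀ n₁ n₂ : ℤ}
    (h : const r * (x 0 ^ n₀ * x 1 ^ n₁ * x 2 ^ n₂) = 1) : r = 1 ∧ n₀ = 0 ∧ n₁ = 0 ∧ n₂ = 0 := by
  have h0 := x_ne_zero (K := L) 0
  have h1 := x_ne_zero (K := L) 1
  have h2 := x_ne_zero (K := L) 2
  have hr : r ≠ 0 := by rintro rfl; simp [const] at h
  have hz : ∀ n : ℤ, n = (n.toNat : ℤ) - ((-n).toNat : ℤ) := fun n => by omega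
  rw [hz n₀, hz n₁, hz n₂] at h
  simp only [zpow_sub₀ h0, zpow_sub₀ h1, zpow_sub₀ h2, zpow_natCast] at h
  have hm : MvPolynomial.monomial (Finsupp.equivFunOnFinite.symm
      ![n₀.toNat, n₁.toNat, n₂.toNat]) r = MvPolynomial.monomial (Finsupp.equivFunOnFinite.symm
      ![(-n₀).toNat, (-n₁).toNat, (-n₂).toNat]) 1 := by
    apply IsFractionRing.injective (MvPolynomial (Fin 3) L) (RatFun3 L)
    rw [algebraMap_monomial, algebraMap_monomial]
    have : (const (1 : L) : RatFun3 L) = 1 := by simp [const]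
    simp only [Finsupp.equivFunOnFinite_symm_apply_apply, Matrix.cons_val, this, one_mul]
    field_simp at h
    linear_combination h
  rw [MvPolynomial.monomial_eq_monomial_iff] at hm
  rcases hm with ⟨hm, hr1⟩ | ⟨hr0, -⟩
  · have hm' := Finsupp.equivFunOnFinite.symm.injective hm
    have e0 := congrFun hm' 0
    have e1 := congrFun hm' 1
    have e2 := congrFun hm' 2
    simp only [Matrix.cons_val] at e0 e1 e2
    exact ⟨hr1, by omega, by omega, by omega⟩
  · exact absurd hr0 hr

end laurent

section semiInvariant

variable {L : Type*} [Field L] {s : L →+* L}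

lemma map_map_involution (hs : ∀ r, s (s r) = r) (p : MvPolynomial (Fin 3) L) :
    MvPolynomial.map s (MvPolynomial.map s p) = p := by
  rw [MvPolynomial.map_map]
  have : s.comp s = RingHom.id L := RingHom.ext hs
  rw [this, MvPolynomial.map_id]

/-- A variant of Hilbert 90: a function with constant norm is a constant times `ē / e`. -/
lemma exists_conj_div (hs : ∀ r, s (s r) = r) {h : RatFun3 L} {κ : L} (hκ : κ ≠ 0)
    (hh : h * baseChange s h = const κ) :
    ∃ e : MvPolynomial (Fin 3) L, e ≠ 0 ∧ IsRelPrime e (MvPolynomial.map s e) ∧ ∃ r : L, r ≠ 0 ∧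
      h * algebraMap _ (RatFun3 L) e = const r * algebraMap _ (RatFun3 L) (MvPolynomial.map s e) := by
  have hinj := IsFractionRing.injective (MvPolynomial (Fin 3) L) (RatFun3 L)
  obtain ⟨f, ⟨e, he⟩, hfe, rfl⟩ := IsFractionRing.exists_reduced_fraction
    (MvPolynomial (Fin 3) L) h
  have he0 : e ≠ 0 := nonZeroDivisors.ne_zero he
  have he0' : algebraMap _ (RatFun3 L) e ≠ 0 := (map_ne_zero_iff _ hinj).2 he0
  have hse0 : MvPolynomial.map s e ≠ 0 :=
    (map_ne_zero_iff _ (MvPolynomial.map_injective s s.injective)).2 he0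
  have hse0' : algebraMap _ (RatFun3 L) (MvPolynomial.map s e) ≠ 0 := (map_ne_zero_iff _ hinj).2 hse0
  rw [IsFractionRing.mk'_eq_div] at hh ⊢
  have hn : f * MvPolynomial.map s f = MvPolynomial.C κ * (e * MvPolynomial.map s e) := by
    apply hinj
    rw [map_div₀, baseChange_algebraMap, baseChange_algebraMap] at hh
    simp only [map_mul, algebraMap_C]
    field_simp at hh
    linear_combination hh
  have hκu : IsUnit (MvPolynomial.C κ : MvPolynomial (Fin 3) L) := (isUnit_iff_ne_zero.2 hκ).map _
  have hfe' : IsRelPrime (MvPolynomial.map s f) (MvPolynomial.map s e) := by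
    intro d hd hd'
    have h1 := hfe (map_dvd (MvPolynomial.map s) hd |>.trans (by rw [map_map_involution hs]))
      (map_dvd (MvPolynomial.map s) hd' |>.trans (by rw [map_map_involution hs]))
    have := h1.map (MvPolynomial.map s)
    rwa [map_map_involution hs] at this
  have h1 : f ∣ MvPolynomial.map s e := by
    have : f ∣ e * MvPolynomial.map s e := (hκu.dvd_mul_left).1 ⟨_, hn.symm⟩
    exact hfe.dvd_of_dvd_mul_left this
  have h2 : MvPolynomial.map s e ∣ f := by
    have : MvPolynomial.map s e ∣ f * MvPolynomial.map s f := by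
      rw [hn]; exact (dvd_mul_left _ _).mul_left _
    exact hfe'.symm.dvd_of_dvd_mul_right this
  obtain ⟨u, hu⟩ := associated_of_dvd_dvd h2 h1
  obtain ⟨r, hr, hru⟩ := MvPolynomial.isUnit_iff_eq_C_of_isReduced.1 u.isUnit
  refine ⟨e, he0, ?_, r, hr.ne_zero, ?_⟩
  · intro d hd hd'
    exact hfe (hd'.trans h2) hd
  · rw [div_mul_cancel₀ _ he0', ← hu, hru, map_mul, algebraMap_C, mul_comm]

lemma exists_laurent_factor {h θ : RatFun3 L} (hθ : θ = 1 ∨ θ = -1)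
    {g : RatFun3 L ≃ₐ[L] RatFun3 L} (hg : ∀ i, g (x i) ∈ laurent L ∧ (g (x i))⁻¹ ∈ laurent L)
    (hgs : ∀ z, baseChange s (g z) = g (baseChange s z)) (hgh : g h = θ * h) (hh0 : h ≠ 0)
    {e : MvPolynomial (Fin 3) L} (he0 : e ≠ 0) (he : IsRelPrime e (MvPolynomial.map s e)) {r : L}
    (hr : r ≠ 0) (hhe : h * algebraMap _ (RatFun3 L) e =
      const r * algebraMap _ (RatFun3 L) (MvPolynomial.map s e)) :
    ∃ v ∈ laurent L, g (algebraMap _ _ e) = v * algebraMap _ _ e ∧ baseChange s v = θ * v := by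
  have hinj := IsFractionRing.injective (MvPolynomial (Fin 3) L) (RatFun3 L)
  have hr' : (const r : RatFun3 L) ≠ 0 := by simpa [const] using hr
  have he0' : algebraMap _ (RatFun3 L) e ≠ 0 := (map_ne_zero_iff _ hinj).2 he0
  have hse0 : MvPolynomial.map s e ≠ 0 :=
    (map_ne_zero_iff _ (MvPolynomial.map_injective s s.injective)).2 he0
  obtain ⟨N, E, hE⟩ := exists_mul_pow_of_mem_laurent
    (map_mem_laurent hg (algebraMap_mem_laurent e))
  obtain ⟨ξ, hξ⟩ : ∃ ξ : RatFun3 L, ξ = (x 0 * x 1 * x 2) ^ N := ⟨_, rfl⟩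
  have hξ0 : ξ ≠ 0 := by
    rw [hξ]
    exact pow_ne_zero _ (mul_ne_zero (mul_ne_zero (x_ne_zero _) (x_ne_zero _)) (x_ne_zero _))
  have hsξ : baseChange s ξ = ξ := by simp [hξ]
  rw [← hξ] at hE
  have hE' : g (algebraMap _ _ (MvPolynomial.map s e)) * ξ =
      algebraMap _ _ (MvPolynomial.map s E) := by
    rw [← baseChange_algebraMap, ← baseChange_algebraMap, ← hE, map_mul, hsξ, hgs]
  have hrel : algebraMap _ (RatFun3 L) (MvPolynomial.map s E) * algebraMap _ _ e =
      θ * algebraMap _ _ (MvPolynomial.map s e) * algebraMap _ _ E := by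
    have h1 := congrArg g hhe
    rw [map_mul, map_mul, map_const, hgh] at h1
    rw [← hE, ← hE', ← mul_right_inj' hr', ← mul_right_inj' hh0]
    linear_combination (-h * ξ * algebraMap _ (RatFun3 L) e) * h1 +
      θ * h * ξ * g (algebraMap _ (RatFun3 L) e) * hhe
  have hsθ : ∃ t : MvPolynomial (Fin 3) L, algebraMap _ _ t = θ := by
    rcases hθ with rfl | rfl
    · exact ⟨1, map_one _⟩
    · exact ⟨-1, by simp⟩
  obtain ⟨t, rfl⟩ := hsθ
  have hrel' : MvPolynomial.map s E * e = t * MvPolynomial.map s e * E := by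
    apply hinj
    simpa only [map_mul] using hrel
  have ht : IsUnit t := by
    rcases hθ with h | h
    · have : t = 1 := hinj (by rw [h, map_one])
      simp [this]
    · have : t = -1 := hinj (by rw [h, map_neg, map_one])
      simp [this]
  have hdvd : e ∣ E := by
    have h1 : e ∣ t * (MvPolynomial.map s e * E) := ⟨MvPolynomial.map s E, by
      rw [← mul_assoc, ← hrel']; ring⟩
    exact he.dvd_of_dvd_mul_left ((ht.dvd_mul_left).1 h1)
  obtain ⟨u, rfl⟩ := hdvd
  have hu : MvPolynomial.map s u = t * u := by
    rw [map_mul] at hrel'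
    refine mul_left_cancel₀ (mul_ne_zero he0 hse0) ?_
    linear_combination hrel'
  refine ⟨algebraMap _ _ u / ξ, ?_, ?_, ?_⟩
  · rw [div_eq_mul_inv, hξ, ← inv_pow, mul_inv, mul_inv]
    exact mul_mem (algebraMap_mem_laurent u) (pow_mem (mul_mem (mul_mem (x_inv_mem_laurent 0)
      (x_inv_mem_laurent 1)) (x_inv_mem_laurent 2)) N)
  · rw [map_mul] at hE
    field_simp
    linear_combination hE
  · rw [map_div₀, baseChange_algebraMap, hu, hsξ, map_mul, mul_div_assoc]

end semiInvariant

section cocycle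

variable {L : Type*} [Field L]

lemma const_div_mem_laurent (u : L) (i : Fin 3) :
    const u / x i ∈ laurent L ∧ (const u / x i)⁻¹ ∈ laurent L := by
  have hinv : (const u : RatFun3 L)⁻¹ = const u⁻¹ := by simp [const]
  rw [inv_div, div_eq_mul_inv, div_eq_mul_inv, hinv]
  exact ⟨mul_mem (const_mem_laurent _) (x_inv_mem_laurent i),
    mul_mem (x_mem_laurent i) (const_mem_laurent _)⟩

lemma neg_x_mem_laurent (i : Fin 3) : -x i ∈ laurent L ∧ (-x i)⁻¹ ∈ laurent L := by
  rw [inv_neg]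
  exact ⟨neg_mem (x_mem_laurent i), neg_mem (x_inv_mem_laurent i)⟩

lemma sigma₁_laurent (b c : Lˣ) (i : Fin 3) :
    sigma₁ (-1) b c (x i) ∈ laurent L ∧ (sigma₁ (-1) b c (x i))⁻¹ ∈ laurent L := by
  obtain ⟨s0, s1, s2⟩ := sigma₁_x (K := L) (-1) b c
  simp only [sgn_neg_one, neg_mul, one_mul] at s0
  fin_cases i
  · exact s0 ▸ neg_x_mem_laurent 0
  · exact s1 ▸ const_div_mem_laurent _ 1
  · exact s2 ▸ const_div_mem_laurent _ 2

lemma sigma₂_laurent (a c : Lˣ) (i : Fin 3) :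
    sigma₂ (-1) (-1) a c (x i) ∈ laurent L ∧ (sigma₂ (-1) (-1) a c (x i))⁻¹ ∈ laurent L := by
  obtain ⟨s0, s1, s2⟩ := sigma₂_x (K := L) (-1) (-1) a c
  have hc : (-const (c : L) : RatFun3 L) = const (-(c : L)) := by simp [const]
  simp only [sgn_neg_one, neg_mul, one_mul, hc] at s1 s2
  fin_cases i
  · exact s0 ▸ const_div_mem_laurent _ 0
  · exact s1 ▸ neg_x_mem_laurent 1
  · exact s2 ▸ const_div_mem_laurent _ 2

lemma const_zpow (r : L) (n : ℤ) : (const (r ^ n) : RatFun3 L) = const r ^ n := map_zpow₀ _ r n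

lemma const_neg_one : (const (-1 : L) : RatFun3 L) = -1 := by simp [const]

/-- A cocycle of monomials for the group generated by `sigma₁` and `sigma₂`. -/
lemma monomial_cocycle (a b c : Lˣ) {v₁ v₂ : RatFun3 L} {r₁ r₂ : L} (hr₁ : r₁ ≠ 0) (hr₂ : r₂ ≠ 0)
    {i j k i' j' k' : ℤ} (hv₁ : v₁ = const r₁ * (x 0 ^ i * x 1 ^ j * x 2 ^ k))
    (hv₂ : v₂ = const r₂ * (x 0 ^ i' * x 1 ^ j' * x 2 ^ k'))
    (h₁ : v₁ * sigma₁ (-1) b c v₁ = 1) (h₂ : v₂ * sigma₂ (-1) (-1) a c v₂ = 1)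
    (h₁₂ : sigma₁ (-1) b c v₂ * v₁ = sigma₂ (-1) (-1) a c v₁ * v₂) :
    r₁ ^ 2 * ((b : L) ^ j * (c : L) ^ k) = 1 ∧
      r₂ ^ 2 * ((a : L) ^ i' * (-c : L) ^ k) = 1 ∧ (-1 : L) ^ i' = (-1) ^ (j + k) := by
  obtain ⟨s0, s1, s2⟩ := sigma₁_x (K := L) (-1) b c
  obtain ⟨t0, t1, t2⟩ := sigma₂_x (K := L) (-1) (-1) a c
  simp only [sgn_neg_one, neg_mul, one_mul] at s0 t1 t2
  have h0 := x_ne_zero (K := L) 0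
  have h1 := x_ne_zero (K := L) 1
  have h2 := x_ne_zero (K := L) 2
  have hneg : ∀ (z : RatFun3 L) (n : ℤ), (-z) ^ n = (-1) ^ n * z ^ n := fun z n => by
    rw [← mul_zpow, neg_one_mul]
  have hcneg : (const (-(c : L)) : RatFun3 L) = -const (c : L) := by simp [const]
  have sv : ∀ (r : L) (i j k : ℤ), sigma₁ (-1) b c (const r * (x 0 ^ i * x 1 ^ j * x 2 ^ k)) =
      const (r * ((-1) ^ i * (b : L) ^ j * (c : L) ^ k)) *
        (x 0 ^ i * x 1 ^ (-j) * x 2 ^ (-k)) := by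
    intro r i j k
    simp only [map_mul, map_zpow₀, s0, s1, s2, map_const, const_mul, const_zpow, const_neg_one,
      hneg (x 0), div_zpow, zpow_neg]
    ring
  have tv : ∀ (r : L) (i j k : ℤ),
      sigma₂ (-1) (-1) a c (const r * (x 0 ^ i * x 1 ^ j * x 2 ^ k)) =
      const (r * ((a : L) ^ i * (-1) ^ j * (-c : L) ^ k)) *
        (x 0 ^ (-i) * x 1 ^ j * x 2 ^ (-k)) := by
    intro r i j k
    simp only [map_mul, map_zpow₀, t0, t1, t2, map_const, const_mul, const_zpow, const_neg_one,
      hneg (x 1), div_zpow, zpow_neg, hcneg]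
    ring
  have hmul : ∀ (r s : L) (i j k i' j' k' : ℤ), const r * (x 0 ^ i * x 1 ^ j * x 2 ^ k) *
      (const s * (x 0 ^ i' * x 1 ^ j' * x 2 ^ k')) =
      const (r * s) * (x 0 ^ (i + i') * x 1 ^ (j + j') * x 2 ^ (k + k')) := by
    intro r s i j k i' j' k'
    rw [zpow_add₀ h0, zpow_add₀ h1, zpow_add₀ h2, const_mul]
    ring
  rw [hv₁, sv, hmul] at h₁
  rw [hv₂, tv, hmul] at h₂
  obtain ⟨e1, hi, -, -⟩ := monomial_eq_one h₁
  obtain ⟨e2, -, hj', -⟩ := monomial_eq_one h₂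
  obtain rfl : i = 0 := by omega
  obtain rfl : j' = 0 := by omega
  rw [hv₁, hv₂, sv, tv, hmul, hmul, ← div_eq_one_iff_eq, mul_div_mul_comm] at h₁₂
  · have hm : ∀ n n' : ℤ, ∀ l : Fin 3, (x l : RatFun3 L) ^ n / x l ^ n' = x l ^ (n - n') :=
      fun n n' l => (zpow_sub₀ (x_ne_zero l) _ _).symm
    have hcd : ∀ r s : L, (const r / const s : RatFun3 L) = const (r / s) := fun r s => by
      simp [const]
    rw [mul_div_mul_comm, mul_div_mul_comm, hm, hm, hm, hcd] at h₁₂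
    obtain ⟨e3, -, -, hk⟩ := monomial_eq_one h₁₂
    obtain rfl : k = k' := by omega
    refine ⟨by simpa [sq, mul_assoc] using e1, by simpa [sq, mul_assoc] using e2, ?_⟩
    have hc0 : (c : L) ^ k ≠ 0 := zpow_ne_zero _ c.ne_zero
    have hnc : (-(c : L)) ^ k = (-1) ^ k * (c : L) ^ k := by rw [← mul_zpow, neg_one_mul]
    have hd : r₁ * ((a : L) ^ (0 : ℤ) * (-1) ^ j * (-c : L) ^ k) * r₂ ≠ 0 := by
      intro h
      rw [h, div_zero] at e3
      exact zero_ne_one e3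
    rw [div_eq_one_iff_eq hd, hnc] at e3
    rw [zpow_add₀ (neg_ne_zero.2 one_ne_zero)]
    simp only [zpow_zero, one_mul, mul_one] at e3
    refine mul_left_cancel₀ (mul_ne_zero (mul_ne_zero hr₁ hr₂) hc0) ?_
    linear_combination e3
  · have hd : r₁ * ((a : L) ^ (0 : ℤ) * (-1) ^ j * (-c : L) ^ k) * r₂ ≠ 0 :=
      mul_ne_zero (mul_ne_zero hr₁ (mul_ne_zero (mul_ne_zero (zpow_ne_zero _ a.ne_zero)
        (zpow_ne_zero _ (neg_ne_zero.2 one_ne_zero)))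
        (zpow_ne_zero _ (neg_ne_zero.2 c.ne_zero)))) hr₂
    exact mul_ne_zero ((map_ne_zero (algebraMap L (RatFun3 L))).2 hd) (mul_ne_zero
      (mul_ne_zero (zpow_ne_zero _ h0) (zpow_ne_zero _ h1)) (zpow_ne_zero _ h2))

end cocycle

lemma isSquare_of_sq_mul_eq_one {k : Type*} [Field k] {r z : k} (h : r ^ 2 * z = 1) :
    IsSquare z := by
  have hr : r ≠ 0 := by rintro rfl; simp at h
  exact ⟨r⁻¹, by field_simp; linear_combination h⟩

/-- The parities of the exponents of a cocycle of monomials determine which constants are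
squares. -/
lemma isSquare_of_cocycle {k : Type*} [Field k] (h2 : (2 : k) ≠ 0) {α a b c r₁ r₂ : k}
    (ha : a ≠ 0) (hb : b ≠ 0) (hc : c ≠ 0) {i j l : ℤ} (h₁ : r₁ ^ 2 * (b ^ j * c ^ l) = 1)
    (h₂ : α * r₂ ^ 2 * (a ^ i * (-c) ^ l) = 1) (h₁₂ : (-1 : k) ^ i = (-1) ^ (j + l)) :
    IsSquare α ∨ IsSquare b ∨ IsSquare c ∨ IsSquare (b * c) ∧ IsSquare (-(α * c)) := by
  have hne : (-1 : k) ≠ 1 := fun h => h2 (by linear_combination -h)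
  have hi : Even (j + l) → Even i := by
    intro hjl
    by_contra hi
    rw [(Int.not_even_iff_odd.1 hi).neg_one_zpow, hjl.neg_one_zpow] at h₁₂
    exact hne h₁₂
  have even_zpow : ∀ {z : k}, z ≠ 0 → ∀ m : ℤ, z ^ (m + m) = (z ^ m) ^ 2 := fun hz m => by
    rw [zpow_add₀ hz, sq]
  have odd_zpow : ∀ {z : k}, z ≠ 0 → ∀ m : ℤ, z ^ (2 * m + 1) = (z ^ m) ^ 2 * z := fun hz m => by
    rw [zpow_add₀ hz, two_mul, even_zpow hz, zpow_one]
  have hc' := neg_ne_zero.2 hc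
  rcases Int.even_or_odd j with hj | hj <;> rcases Int.even_or_odd l with hl | hl
  · obtain ⟨n, rfl⟩ := hi (hj.add hl)
    obtain ⟨m, rfl⟩ := hl
    rw [even_zpow ha, even_zpow hc'] at h₂
    exact Or.inl (isSquare_of_sq_mul_eq_one (r := r₂ * a ^ n * (-c) ^ m)
      (by linear_combination h₂))
  · obtain ⟨n, rfl⟩ := hj
    obtain ⟨m, rfl⟩ := hl
    rw [even_zpow hb, odd_zpow hc] at h₁
    exact Or.inr (Or.inr (Or.inl (isSquare_of_sq_mul_eq_one (r := r₁ * b ^ n * c ^ m)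
      (by linear_combination h₁))))
  · obtain ⟨n, rfl⟩ := hj
    obtain ⟨m, rfl⟩ := hl
    rw [odd_zpow hb, even_zpow hc] at h₁
    exact Or.inr (Or.inl (isSquare_of_sq_mul_eq_one (r := r₁ * b ^ n * c ^ m)
      (by linear_combination h₁)))
  · obtain ⟨q, rfl⟩ := hi (hj.add_odd hl)
    obtain ⟨n, rfl⟩ := hj
    obtain ⟨m, rfl⟩ := hl
    rw [odd_zpow hb, odd_zpow hc] at h₁
    rw [even_zpow ha, odd_zpow hc'] at h₂
    exact Or.inr (Or.inr (Or.inr ⟨isSquare_of_sq_mul_eq_one (r := r₁ * b ^ n * c ^ m)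
      (by linear_combination h₁), isSquare_of_sq_mul_eq_one (r := r₂ * a ^ q * (-c) ^ m)
      (by linear_combination h₂)⟩))

open QuadraticAlgebra in
/-- The extension by the square root of a nonsquare, with its conjugation. -/
lemma exists_quadratic_extension.{u} {k : Type u} [Field k] (h2 : (2 : k) ≠ 0) {α : k}
    (hα : ¬ IsSquare α) :
    ∃ (L : Type u) (_ : Field L) (_ : Algebra k L) (s : L →+* L) (w : L),
      Algebra.IsAlgebraic k L ∧ (∀ r, s (s r) = r) ∧ (∀ r, s (algebraMap k L r) = algebraMap k L r) ∧
      (∀ r, s r = r → ∃ t, algebraMap k L t = r) ∧ w ^ 2 = algebraMap k L α ∧ s w = -w ∧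
      ∀ t : k, IsSquare (algebraMap k L t) → IsSquare t ∨ IsSquare (α * t) := by
  have : Fact (∀ r : k, r ^ 2 ≠ α + 0 * r) :=
    ⟨fun r hr => hα ⟨r, by linear_combination -hr⟩⟩
  have hα0 : α ≠ 0 := by rintro rfl; exact hα ⟨0, by simp⟩
  refine ⟨QuadraticAlgebra k α 0, inferInstance, inferInstance,
    starRingEnd (QuadraticAlgebra k α 0), ω, inferInstance, star_star, ?_, ?_, ?_, ?_, ?_⟩
  · intro r
    ext <;> simp [starRingEnd_apply]
  · intro r hr
    have := congrArg QuadraticAlgebra.im hr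
    rw [starRingEnd_apply, im_star] at this
    have him : r.im = 0 := by
      have : 2 * r.im = 0 := by linear_combination -this
      exact (mul_eq_zero.1 this).resolve_left h2
    exact ⟨r.re, by ext <;> simp [him]⟩
  · ext <;> simp [sq]
  · ext <;> simp [starRingEnd_apply]
  · rintro t ⟨z, hz⟩
    have h1 := congrArg QuadraticAlgebra.re hz
    have h3 := congrArg QuadraticAlgebra.im hz
    simp only [algebraMap_re, algebraMap_im, re_mul, im_mul] at h1 h3
    have h4 : 2 * (z.re * z.im) = 0 := by linear_combination -h3
    rcases mul_eq_zero.1 ((mul_eq_zero.1 h4).resolve_left h2) with h | h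
    · refine Or.inr ⟨α * z.im, ?_⟩
      rw [h] at h1
      linear_combination α * h1
    · refine Or.inl ⟨z.re, ?_⟩
      rw [h] at h1
      linear_combination h1

section descent

variable {k L : Type*} [Field k] [Field L] [Algebra k L]

lemma sigma₁_sigma₁ (b c : kˣ) (z : RatFun3 k) :
    sigma₁ (-1) b c (sigma₁ (-1) b c z) = z := by
  obtain ⟨s0, s1, s2⟩ := sigma₁_x (K := k) (-1) b c
  have hb := const_ne_zero b
  have hc := const_ne_zero c
  have : (sigma₁ (-1) b c).toAlgHom.comp (sigma₁ (-1) b c).toAlgHom = AlgHom.id k _ := by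
    refine algHom_ext fun i => ?_
    fin_cases i
    · simp [s0]
    · simp [s1, map_const, div_div_cancel₀ hb]
    · simp [s2, map_const, div_div_cancel₀ hc]
  exact DFunLike.congr_fun this z

lemma sigma₂_sigma₂ (a c : kˣ) (z : RatFun3 k) :
    sigma₂ (-1) (-1) a c (sigma₂ (-1) (-1) a c z) = z := by
  obtain ⟨s0, s1, s2⟩ := sigma₂_x (K := k) (-1) (-1) a c
  have ha := const_ne_zero a
  have hc := const_ne_zero c
  have : (sigma₂ (-1) (-1) a c).toAlgHom.comp (sigma₂ (-1) (-1) a c).toAlgHom =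
      AlgHom.id k _ := by
    refine algHom_ext fun i => ?_
    fin_cases i
    · simp [s0, map_const, div_div_cancel₀ ha]
    · simp [s1]
    · simp [s2, map_const, div_div_cancel₀ (neg_ne_zero.2 hc)]
  exact DFunLike.congr_fun this z

lemma sigma₁_sigma₂ (a b c : kˣ) (z : RatFun3 k) :
    sigma₁ (-1) b c (sigma₂ (-1) (-1) a c z) = sigma₂ (-1) (-1) a c (sigma₁ (-1) b c z) := by
  obtain ⟨s0, s1, s2⟩ := sigma₁_x (K := k) (-1) b c
  obtain ⟨t0, t1, t2⟩ := sigma₂_x (K := k) (-1) (-1) a c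
  have : (sigma₁ (-1) b c).toAlgHom.comp (sigma₂ (-1) (-1) a c).toAlgHom =
      (sigma₂ (-1) (-1) a c).toAlgHom.comp (sigma₁ (-1) b c).toAlgHom := by
    refine algHom_ext fun i => ?_
    fin_cases i
    · simp [s0, t0, map_const, div_neg]
    · simp [s1, t1, map_const, div_neg]
    · simp [s2, t2, map_const, neg_div, div_neg]
  exact DFunLike.congr_fun this z

variable {s : L →+* L} {ω : L}

/-- A semi-invariant of norm a constant, for the field extended by a square root of `α`. -/
lemma isSquare_of_semiInvariant (h2 : (2 : k) ≠ 0) {α : k} (hss : ∀ r, s (s r) = r)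
    (hfix : ∀ r, s r = r → ∃ t, algebraMap k L t = r) (hω : ω ^ 2 = algebraMap k L α)
    (hω0 : ω ≠ 0) (hsω : s ω = -ω) (a b c : kˣ) (a' b' c' : Lˣ)
    (ha : (a' : L) = algebraMap k L a) (hb : (b' : L) = algebraMap k L b)
    (hc : (c' : L) = algebraMap k L c) (hs : ∀ r, s (algebraMap k L r) = algebraMap k L r)
    {h : RatFun3 L} {κ : L} (hκ : κ ≠ 0) (hh : h * baseChange s h = const κ)
    (h₁ : sigma₁ (-1) b' c' h = h) (h₂ : sigma₂ (-1) (-1) a' c' h = -h) :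
    IsSquare α ∨ IsSquare (b : k) ∨ IsSquare (c : k) ∨
      IsSquare (b * c : k) ∧ IsSquare (-(α * c)) := by
  have hinj := (algebraMap k L).injective
  have hh0 : h ≠ 0 := by
    rintro rfl
    rw [zero_mul, const, eq_comm, map_eq_zero] at hh
    exact hκ hh
  have hgs₁ : ∀ z, baseChange s (sigma₁ (-1) b' c' z) = sigma₁ (-1) b' c' (baseChange s z) :=
    baseChange_sigma₁ s (-1) (by rw [hb, hs]) (by rw [hc, hs])
  have hgs₂ : ∀ z, baseChange s (sigma₂ (-1) (-1) a' c' z) =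
      sigma₂ (-1) (-1) a' c' (baseChange s z) :=
    baseChange_sigma₂ s (-1) (-1) (by rw [ha, hs]) (by rw [hc, hs])
  obtain ⟨e, he0, he, r, hr, hhe⟩ := exists_conj_div hss hκ hh
  obtain ⟨v₁, hv₁, hev₁, hsv₁⟩ := exists_laurent_factor (Or.inl rfl) (sigma₁_laurent b' c') hgs₁
    (by rw [h₁, one_mul]) hh0 he0 he hr hhe
  obtain ⟨v₂, hv₂, hev₂, hsv₂⟩ := exists_laurent_factor (Or.inr rfl) (sigma₂_laurent a' c') hgs₂
    (by rw [h₂, neg_one_mul]) hh0 he0 he hr hhe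
  have he0' : algebraMap _ (RatFun3 L) e ≠ 0 :=
    (map_ne_zero_iff _ (IsFractionRing.injective (MvPolynomial (Fin 3) L) (RatFun3 L))).2 he0
  have c₁ : v₁ * sigma₁ (-1) b' c' v₁ = 1 := by
    have := sigma₁_sigma₁ b' c' (algebraMap _ _ e)
    rw [hev₁, map_mul, hev₁] at this
    refine mul_right_cancel₀ he0' ?_
    linear_combination this
  have c₂ : v₂ * sigma₂ (-1) (-1) a' c' v₂ = 1 := by
    have := sigma₂_sigma₂ a' c' (algebraMap _ _ e)
    rw [hev₂, map_mul, hev₂] at this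
    refine mul_right_cancel₀ he0' ?_
    linear_combination this
  have c₁₂ : sigma₁ (-1) b' c' v₂ * v₁ = sigma₂ (-1) (-1) a' c' v₁ * v₂ := by
    have := sigma₁_sigma₂ a' b' c' (algebraMap _ _ e)
    rw [hev₁, hev₂, map_mul, map_mul, hev₁, hev₂] at this
    refine mul_right_cancel₀ he0' ?_
    linear_combination this
  obtain ⟨r₁, hr₁, i, j, l, hv₁'⟩ := eq_monomial_of_mul_eq_one hv₁
    (map_mem_laurent (sigma₁_laurent b' c') hv₁) c₁
  obtain ⟨r₂, hr₂, i', j', l', hv₂'⟩ := eq_monomial_of_mul_eq_one hv₂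
    (map_mem_laurent (sigma₂_laurent a' c') hv₂) c₂
  obtain ⟨e₁, e₂, e₃⟩ := monomial_cocycle a' b' c' hr₁ hr₂ hv₁' hv₂' c₁ c₂ c₁₂
  have hmon : ∀ (t : L) (i j l : ℤ), baseChange s (const t * (x 0 ^ i * x 1 ^ j * x 2 ^ l)) =
      const (s t) * (x 0 ^ i * x 1 ^ j * x 2 ^ l) := by
    intro t i j l
    simp [map_zpow₀]
  have hm0 : ∀ i j l : ℤ, (x 0 ^ i * x 1 ^ j * x 2 ^ l : RatFun3 L) ≠ 0 := fun i j l =>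
    mul_ne_zero (mul_ne_zero (zpow_ne_zero _ (x_ne_zero 0)) (zpow_ne_zero _ (x_ne_zero 1)))
      (zpow_ne_zero _ (x_ne_zero 2))
  have hconst : Function.Injective (const : L → RatFun3 L) := (algebraMap L (RatFun3 L)).injective
  obtain ⟨t₁, rfl⟩ := hfix r₁ <| by
    rw [hv₁', hmon, one_mul] at hsv₁
    exact hconst (mul_right_cancel₀ (hm0 _ _ _) hsv₁)
  obtain ⟨t₂, ht₂⟩ := hfix (r₂ / ω) <| by
    rw [hv₂', hmon, neg_one_mul, ← neg_mul] at hsv₂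
    have h3 := mul_right_cancel₀ (hm0 _ _ _) hsv₂
    rw [show (-const r₂ : RatFun3 L) = const (-r₂) by simp [const]] at h3
    rw [map_div₀, hconst h3, hsω, neg_div_neg_eq]
  obtain rfl : r₂ = ω * algebraMap k L t₂ := by rw [ht₂]; field_simp
  refine isSquare_of_cocycle h2 a.ne_zero b.ne_zero c.ne_zero (i := i') (j := j) (l := l)
    (r₁ := t₁) (r₂ := t₂) (hinj ?_) (hinj ?_) (hinj ?_)
  · simpa [map_zpow₀, hb, hc] using e₁
  · rw [mul_pow, hω] at e₂
    simpa [map_zpow₀, ha, hc] using e₂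
  · simpa [map_zpow₀] using e₃

end descent

/-- If `u D²` is a norm of invariants from the extension by the square root of `α`, where `D` is
invariant under `σ₁` and changes its sign under `σ₂`, then there are squares among the constants. -/
lemma isSquare_of_norm_eq {k : Type*} [Field k] (h2 : (2 : k) ≠ 0) (a b c : kˣ) {α u : k}
    (hu : u ≠ 0) {D X Y : RatFun3 k} (hD0 : D ≠ 0)
    (hD₁ : sigma₁ (-1) b c D = D) (hD₂ : sigma₂ (-1) (-1) a c D = -D)
    (hX : X ∈ noether3311 (-1) (-1) (-1) a b c) (hY : Y ∈ noether3311 (-1) (-1) (-1) a b c)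
    (h : const u * D ^ 2 = X ^ 2 - const α * Y ^ 2) :
    IsSquare α ∨ IsSquare (b : k) ∨ IsSquare (c : k) ∨
      IsSquare (b * c : k) ∧ IsSquare (-(α * c)) := by
  by_cases hα : IsSquare α
  · exact Or.inl hα
  obtain ⟨L, _, _, s, ω, -, hss, hs, hfix, hω, hsω, -⟩ := exists_quadratic_extension h2 hα
  have hω0 : ω ≠ 0 := by
    rintro rfl
    rw [zero_pow two_ne_zero, eq_comm, map_eq_zero] at hω
    exact hα ⟨0, by simp [hω]⟩
  obtain ⟨hX₁, hX₂⟩ := mem_noether3311.1 hX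
  obtain ⟨hY₁, hY₂⟩ := mem_noether3311.1 hY
  set ι : RatFun3 k →+* RatFun3 L := baseChange (algebraMap k L) with hι
  have hsι : ∀ z, baseChange s (ι z) = ι z := by
    intro z
    have : (baseChange s).comp ι = ι := ringHom_ext (fun r => by simp [hι, hs]) fun i => by
      simp [hι]
    exact DFunLike.congr_fun this z
  have hDι : ι D ≠ 0 := (map_ne_zero ι).2 hD0
  let φ : k →* L := (algebraMap k L : k →* L)
  have hφ₁ : ∀ z, ι (sigma₁ (-1) b c z) =
      sigma₁ (-1) (Units.map φ b) (Units.map φ c) (ι z) := baseChange_sigma₁ _ _ rfl rfl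
  have hφ₂ : ∀ z, ι (sigma₂ (-1) (-1) a c z) =
      sigma₂ (-1) (-1) (Units.map φ a) (Units.map φ c) (ι z) := baseChange_sigma₂ _ _ _ rfl rfl
  have hN := congrArg ι h
  simp only [map_mul, map_sub, map_pow, hι, baseChange_const, ← hω] at hN
  rw [← hι] at hN
  simp only [const, map_pow] at hN
  refine isSquare_of_semiInvariant h2 hss hfix hω hω0 hsω a b c (Units.map φ a) (Units.map φ b)
    (Units.map φ c) rfl rfl rfl hs (h := (ι X + const ω * ι Y) / ι D) (κ := algebraMap k L u)
    ((map_ne_zero _).2 hu) ?_ ?_ ?_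
  · simp only [map_div₀, map_add, map_mul, baseChange_const, hsι, hsω]
    simp only [const, map_neg]
    field_simp
    linear_combination -hN
  · simp only [map_div₀, map_add, map_mul, ← hφ₁, map_const, hX₁, hY₁, hD₁]
  · simp only [map_div₀, map_add, map_mul, ← hφ₂, map_const, hX₂, hY₂, hD₂, map_neg, div_neg]

lemma isScaledNorm_mul_of_conics_of_equiv {k F : Type*} [Field k] [Field F] [Algebra k F]
    {σ : Type*} (φ : F ≃ₐ[k] FractionRing (MvPolynomial σ k)) {α : k} (hα : ¬ IsSquare α) {δ : k}
    {S T : F} (hS : S ≠ 0) (hT : T ≠ 0) (hST : T = S - algebraMap k F δ)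
    {e p q e' p' q' : k} (he : e ≠ 0) (hq : q ≠ 0) (he' : e' ≠ 0) (hq' : q' ≠ 0)
    {X U V X' U' V' : F} (h0 : ¬ (X = 0 ∧ U = 0 ∧ V = 0)) (h0' : ¬ (X' = 0 ∧ U' = 0 ∧ V' = 0))
    (h : X ^ 2 - algebraMap k F α * (algebraMap k F e * U) ^ 2 =
      S * (algebraMap k F p * U ^ 2 + algebraMap k F q * V ^ 2))
    (h' : X' ^ 2 - algebraMap k F α * (algebraMap k F e' * U') ^ 2 =
      T * (algebraMap k F p' * U' ^ 2 + algebraMap k F q' * V' ^ 2)) :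
    IsScaledNorm α (S * T) := by
  have key := isScaledNorm_mul_of_conics σ hα (S := φ S) (T := φ T) (δ := δ)
    ((map_ne_zero φ).2 hS) ((map_ne_zero φ).2 hT) (by rw [hST, map_sub, φ.commutes])
    he hq he' hq' (X := φ X) (U := φ U) (V := φ V) (X' := φ X') (U' := φ U') (V' := φ V')
    (by simpa using h0) (by simpa using h0')
    (by simpa only [map_sub, map_pow, map_mul, map_add, AlgEquiv.commutes] using congrArg φ h)
    (by simpa only [map_sub, map_pow, map_mul, map_add, AlgEquiv.commutes] using congrArg φ h')
  obtain ⟨u, hu, A, B, hAB⟩ := key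
  refine ⟨u, hu, φ.symm A, φ.symm B, φ.injective ?_⟩
  simpa only [map_sub, map_pow, map_mul, AlgEquiv.commutes, AlgEquiv.apply_symm_apply] using hAB

section extendScalars

variable {k : Type*} [Field k] [Algebra K k]

/-- Extension of scalars of rational functions, over the smaller field. -/
def baseChangeAlgHom (K k : Type*) [Field K] [Field k] [Algebra K k] :
    RatFun3 K →ₐ[K] RatFun3 k where
  __ := baseChange (algebraMap K k)
  commutes' r := (baseChange_const _ r).trans (IsScalarTower.algebraMap_apply K k _ r).symm

/-- If the Noether problem is affirmative, then after an algebraic extension of the constants the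
image of the invariant field lies in a rational field of invariants. -/
lemma Affirmative.exists_rational [Algebra.IsAlgebraic K k] {ε₁ ε₂ ε₃ : ℤˣ} {a b c : Kˣ}
    (h : Affirmative (noether3311 ε₁ ε₂ ε₃ a b c)) {a' b' c' : kˣ}
    (ha : (a' : k) = algebraMap K k a) (hb : (b' : k) = algebraMap K k b)
    (hc : (c' : k) = algebraMap K k c) :
    ∃ (n : ℕ) (M : IntermediateField k (RatFun3 k)),
      Nonempty (M ≃ₐ[k] FractionRing (MvPolynomial (Fin n) k)) ∧
      M ≤ noether3311 ε₁ ε₂ ε₃ a' b' c' ∧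
      ∀ z ∈ noether3311 ε₁ ε₂ ε₃ a b c, baseChange (algebraMap K k) z ∈ M := by
  obtain ⟨n, ⟨φ⟩⟩ := h
  let ψ : FractionRing (MvPolynomial (Fin n) K) →ₐ[K] RatFun3 k := (baseChangeAlgHom K k).comp
    ((IntermediateField.val (noether3311 ε₁ ε₂ ε₃ a b c)).comp φ.symm.toAlgHom)
  let ψ' : MvPolynomial (Fin n) K →ₐ[K] RatFun3 k := ψ.comp (IsScalarTower.toAlgHom K _ _)
  have hψ : Function.Injective ψ := ψ.toRingHom.injective
  let t : Fin n → RatFun3 k := fun i => ψ' (MvPolynomial.X i)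
  have htK : AlgebraicIndependent K t := (MvPolynomial.algebraicIndependent_X (Fin n) K).map'
    (f := ψ') (hψ.comp (IsFractionRing.injective _ _))
  have ht : AlgebraicIndependent k t := htK.extendScalars k
  let M := IntermediateField.adjoin k (Set.range t)
  refine ⟨n, M, ⟨ht.aevalEquivField.symm⟩, ?_, ?_⟩
  · rw [IntermediateField.adjoin_le_iff]
    rintro _ ⟨i, rfl⟩
    obtain ⟨h₁, h₂⟩ := mem_noether3311.1
      (φ.symm (algebraMap (MvPolynomial (Fin n) K) _ (MvPolynomial.X i))).2
    refine mem_noether3311.2 ⟨?_, ?_⟩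
    · exact (baseChange_sigma₁ _ ε₁ hb hc _).symm.trans (congrArg (baseChange _) h₁)
    · exact (baseChange_sigma₂ _ ε₂ ε₃ ha hc _).symm.trans (congrArg (baseChange _) h₂)
  · have hp : ∀ p, ψ' p ∈ M := by
      intro p
      induction p using MvPolynomial.induction_on with
      | C r =>
        have : ψ' (MvPolynomial.C r) = algebraMap k _ (algebraMap K k r) :=
          (ψ'.commutes r).trans (IsScalarTower.algebraMap_apply K k _ r)
        exact this ▸ M.algebraMap_mem _
      | add p q hp hq => rw [map_add]; exact M.add_mem hp hq
      | mul_X p i hp =>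
        rw [map_mul]
        exact M.mul_mem hp (IntermediateField.subset_adjoin k _ ⟨i, rfl⟩)
    intro z hz
    obtain ⟨p, q, -, hpq⟩ := IsFractionRing.div_surjective (A := MvPolynomial (Fin n) K)
      (φ ⟨z, hz⟩)
    have : baseChange (algebraMap K k) z = ψ' p / ψ' q := by
      have h1 : ψ (φ ⟨z, hz⟩) = baseChange (algebraMap K k) z := by
        change baseChange (algebraMap K k) (φ.symm (φ ⟨z, hz⟩) : noether3311 ε₁ ε₂ ε₃ a b c) = _
        rw [φ.symm_apply_apply]
      rw [← h1, ← hpq, map_div₀]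
      rfl
    rw [this]
    exact M.div_mem (hp p) (hp q)

end extendScalars

section conics

/-- The invariants that satisfy the conics `y₁² - S y₂² = -b T` and `z₁² - T z₂² = -c S`. -/
lemma conic_mem_noether3311 (a b c : Kˣ) :
    let P := plusPart (const (a : K)) (x 0)
    let Q := minusPart (const (a : K)) (x 0)
    P ^ 2 ∈ noether3311 (-1) (-1) (-1) a b c ∧
    Q * minusPart (const (b : K)) (x 1) ∈ noether3311 (-1) (-1) (-1) a b c ∧
    Q * plusPart (const (b : K)) (x 1) / P ∈ noether3311 (-1) (-1) (-1) a b c ∧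
    P * minusPart (const (c : K)) (x 2) ∈ noether3311 (-1) (-1) (-1) a b c ∧
    P * plusPart (const (c : K)) (x 2) / Q ∈ noether3311 (-1) (-1) (-1) a b c := by
  intro P Q
  obtain ⟨s0, s1, s2⟩ := sigma₁_x (K := K) (-1) b c
  obtain ⟨t0, t1, t2⟩ := sigma₂_x (K := K) (-1) (-1) a c
  simp only [sgn_neg_one, neg_mul, one_mul] at s0 t1 t2
  obtain ⟨s0p, s0m⟩ := map_parts_neg (a := (a : K)) s0
  obtain ⟨s1p, s1m⟩ := map_parts_inv (const_ne_zero b) (x_ne_zero 1) s1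
  obtain ⟨s2p, s2m⟩ := map_parts_inv (const_ne_zero c) (x_ne_zero 2) s2
  obtain ⟨t0p, t0m⟩ := map_parts_inv (const_ne_zero a) (x_ne_zero 0) t0
  obtain ⟨t1p, t1m⟩ := map_parts_neg (a := (b : K)) t1
  obtain ⟨t2p, t2m⟩ := map_parts_neg_inv (const_ne_zero c) (x_ne_zero 2) t2
  simp only [mem_noether3311, map_mul, map_div₀, map_pow, P, Q, s0p, s0m, s1p, s1m, s2p, s2m, t0p,
    t0m, t1p, t1m, t2p, t2m, neg_sq, neg_mul, mul_neg, neg_div_neg_eq, neg_neg,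
    and_self]

lemma baseChange_parts {k : Type*} [Field k] (j : K →+* k) (a : K) (i : Fin 3) :
    baseChange j (plusPart (const a) (x i)) = plusPart (const (j a)) (x i) ∧
      baseChange j (minusPart (const a) (x i)) = minusPart (const (j a)) (x i) := by
  simp [plusPart, minusPart, map_ofNat (baseChange j) 2]

variable {k : Type*} [Field k] [Algebra K k] [Algebra.IsAlgebraic K k]

/-- The conics of the invariant field over a rational field of invariants. -/
lemma Affirmative.exists_conics (h2 : (2 : k) ≠ 0) {a b c : Kˣ}
    (h : Affirmative (noether3311 (-1) (-1) (-1) a b c)) {a' b' c' : kˣ}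
    (ha : (a' : k) = algebraMap K k a) (hb : (b' : k) = algebraMap K k b)
    (hc : (c' : k) = algebraMap K k c) {α : k}
    (H : ∀ (n : ℕ) (F : IntermediateField k (RatFun3 k)),
      (F ≃ₐ[k] FractionRing (MvPolynomial (Fin n) k)) → ∀ S T y₁ y₂ z₁ z₂ : F, S ≠ 0 → T ≠ 0 →
      y₁ ≠ 0 → z₁ ≠ 0 → T = S - algebraMap k F a' →
      y₁ ^ 2 - S * y₂ ^ 2 = -algebraMap k F b' * T →
      z₁ ^ 2 - T * z₂ ^ 2 = -algebraMap k F c' * S → IsScaledNorm α (S * T)) :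
    IsSquare α ∨ IsSquare (b' : k) ∨ IsSquare (c' : k) ∨
      IsSquare (b' * c' : k) ∧ IsSquare (-(α * c')) := by
  obtain ⟨n, M, ⟨φ⟩, hMN, hM⟩ := h.exists_rational ha hb hc
  have h2' := two_ne_zero_ratFun3 h2
  obtain ⟨m0, m1, m2, m3, m4⟩ := conic_mem_noether3311 a b c
  replace m0 := hM _ m0
  replace m1 := hM _ m1
  replace m2 := hM _ m2
  replace m3 := hM _ m3
  replace m4 := hM _ m4
  simp only [map_mul, map_div₀, map_pow, (baseChange_parts _ _ _).1, (baseChange_parts _ _ _).2,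
    ← ha, ← hb, ← hc] at m0 m1 m2 m3 m4
  have hA := plusPart_sq h2' (const (a' : k)) (x_ne_zero 0)
  have hB := plusPart_sq h2' (const (b' : k)) (x_ne_zero 1)
  have hC := plusPart_sq h2' (const (c' : k)) (x_ne_zero 2)
  have hP := plusPart_ne_zero h2' 0 a'
  have hQ := minusPart_ne_zero h2' 0 a'
  have hB0 := minusPart_ne_zero h2' 1 b'
  have hC0 := minusPart_ne_zero h2' 2 c'
  obtain ⟨s0, s1, s2⟩ := sigma₁_x (K := k) (-1) b' c'
  obtain ⟨t0, t1, t2⟩ := sigma₂_x (K := k) (-1) (-1) a' c'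
  simp only [sgn_neg_one, neg_mul, one_mul] at s0 t1 t2
  obtain ⟨s0p, s0m⟩ := map_parts_neg (a := (a' : k)) s0
  obtain ⟨t0p, t0m⟩ := map_parts_inv (const_ne_zero a') (x_ne_zero 0) t0
  generalize plusPart (const (a' : k)) (x 0) = P at *
  generalize minusPart (const (a' : k)) (x 0) = Q at *
  have mT : Q ^ 2 ∈ M := by
    have : Q ^ 2 = P ^ 2 - const (a' : k) := by linear_combination -hA
    exact this ▸ M.sub_mem m0 (const_mem M _)
  obtain ⟨u, hu, X, Y, hXY⟩ := H n M φ ⟨_, m0⟩ ⟨_, mT⟩ ⟨_, m1⟩ ⟨_, m2⟩ ⟨_, m3⟩ ⟨_, m4⟩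
    (fun h0 => pow_ne_zero 2 hP (congrArg Subtype.val h0))
    (fun h0 => pow_ne_zero 2 hQ (congrArg Subtype.val h0))
    (fun h0 => mul_ne_zero hQ hB0 (congrArg Subtype.val h0))
    (fun h0 => mul_ne_zero hP hC0 (congrArg Subtype.val h0))
    (Subtype.ext (by
      change Q ^ 2 = P ^ 2 - const (a' : k)
      linear_combination -hA))
    (Subtype.ext (by
      change (Q * minusPart (const (b' : k)) (x 1)) ^ 2 -
        P ^ 2 * (Q * plusPart (const (b' : k)) (x 1) / P) ^ 2 = -const (b' : k) * Q ^ 2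
      field_simp
      linear_combination -hB))
    (Subtype.ext (by
      change (P * minusPart (const (c' : k)) (x 2)) ^ 2 -
        Q ^ 2 * (P * plusPart (const (c' : k)) (x 2) / Q) ^ 2 = -const (c' : k) * P ^ 2
      field_simp
      linear_combination -hC))
  refine isSquare_of_norm_eq h2 a' b' c' hu (D := P * Q) (X := X) (Y := Y) (mul_ne_zero hP hQ)
    (by rw [map_mul, s0p, s0m, neg_mul_neg]) (by rw [map_mul, t0p, t0m, mul_neg])
    (hMN X.2) (hMN Y.2) ?_
  have := congrArg Subtype.val hXY
  rw [mul_pow]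
  exact this

end conics

section negative

variable {a b c : Kˣ}

lemma Affirmative.isSquare_of_isSquare_neg_one {k : Type*} [Field k] [Algebra K k]
    [Algebra.IsAlgebraic K k] (h2 : (2 : k) ≠ 0) (hi : IsSquare (-1 : k))
    (h : Affirmative (noether3311 (-1) (-1) (-1) a b c)) :
    IsSquare (algebraMap K k a) ∨ IsSquare (algebraMap K k b) ∨ IsSquare (algebraMap K k c) ∨
      IsSquare (algebraMap K k (b * c)) ∧ IsSquare (algebraMap K k (-(a * c))) := by
  obtain ⟨i, hi⟩ := hi
  have hi0 : i ≠ 0 := by rintro rfl; simp at hi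
  by_cases ha : IsSquare (algebraMap K k a)
  · exact Or.inl ha
  let φ : K →* k := (algebraMap K k : K →* k)
  have key := h.exists_conics h2 (a' := Units.map φ a) (b' := Units.map φ b) (c' := Units.map φ c)
    rfl rfl rfl (α := algebraMap K k a) ?_
  · rw [map_mul, map_neg, map_mul]
    exact key
  · intro n F e S T y₁ y₂ z₁ z₂ hS hT hy hz hST hy' hz'
    have hi' : algebraMap k F i * algebraMap k F i = -1 := by rw [← map_mul, ← hi]; simp
    refine isScaledNorm_mul_of_conics_of_equiv e ha hS hT hST (e := i) (p := 1)
      (q := -(Units.map φ c : kˣ)) (e' := 1) (p' := 1) (q' := -(Units.map φ b : kˣ))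
      (X := z₁) (U := z₂) (V := 1) (X' := y₁) (U' := y₂) (V' := 1) hi0
      (neg_ne_zero.2 (Units.ne_zero _)) one_ne_zero (neg_ne_zero.2 (Units.ne_zero _))
      (fun h => hz h.1) (fun h => hy h.1) ?_ ?_
    · rw [map_one, map_neg]
      change z₁ ^ 2 - algebraMap k F (Units.map φ a : kˣ) * _ = _
      rw [mul_pow]
      linear_combination hz' + z₂ ^ 2 * hST -
        algebraMap k F (Units.map φ a : kˣ) * z₂ ^ 2 * hi'
    · rw [map_one, map_neg]
      change y₁ ^ 2 - algebraMap k F (Units.map φ a : kˣ) * _ = _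
      linear_combination hy' - y₂ ^ 2 * hST

lemma Affirmative.isSquare_of_isSquare_neg_mul (h2 : (2 : K) ≠ 0) (hab : IsSquare (-(a * b) : K))
    (hac : IsSquare (a * c : K)) (h : Affirmative (noether3311 (-1) (-1) (-1) a b c)) :
    IsSquare (-1 : K) ∨ IsSquare (b : K) ∨ IsSquare (c : K) ∨ IsSquare (b * c : K) := by
  by_cases hi : IsSquare (-1 : K)
  · exact Or.inl hi
  obtain ⟨m, hm⟩ := hab
  obtain ⟨n, hn⟩ := hac
  have hm0 : m ≠ 0 := by rintro rfl; simp at hm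
  have hn0 : n ≠ 0 := by rintro rfl; simp at hn
  have key := h.exists_conics h2 (a' := a) (b' := b) (c' := c) rfl rfl rfl (α := -1) ?_
  · exact key.imp_right (Or.imp_right (Or.imp_right And.left))
  · intro _ F e S T y₁ y₂ z₁ z₂ hS hT hy hz hST hy' hz'
    have hm' := congrArg (algebraMap K F) hm
    have hn' := congrArg (algebraMap K F) hn
    simp only [map_mul, map_neg] at hm' hn'
    refine isScaledNorm_mul_of_conics_of_equiv e hi hS hT hST (e := m) (p := -b) (q := 1)
      (e' := n) (p' := -c) (q' := 1) (X := y₁) (U := 1) (V := y₂) (X' := z₁) (U' := 1)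
      (V' := z₂) hm0 one_ne_zero hn0 one_ne_zero (fun h => hy h.1) (fun h => hz h.1) ?_ ?_
    · simp only [map_one, map_neg]
      linear_combination hy' - algebraMap K F b * hST - hm'
    · simp only [map_one, map_neg]
      linear_combination hz' + algebraMap K F c * hST - hn'

lemma isSquare_units {u : Kˣ} (h : IsSquare (u : K)) : IsSquare u := by
  obtain ⟨r, hr⟩ := h
  have hr0 : r ≠ 0 := by rintro rfl; simp at hr
  exact ⟨Units.mk0 r hr0, Units.ext hr⟩

theorem not_affirmative_of_not_isSquare (h2 : (2 : K) ≠ 0) (ha : ¬ IsSquare (a : K))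
    (ha' : ¬ IsSquare (-a : K)) (hb : ¬ IsSquare (b : K)) (hb' : ¬ IsSquare (-b : K))
    (hc : ¬ IsSquare (c : K)) (hc' : ¬ IsSquare (-c : K)) (hac : ¬ IsSquare (-(a * c) : K))
    (hbc : ¬ IsSquare (b * c : K)) :
    ¬ Affirmative (noether3311 (-1) (-1) (-1) a b c) := by
  intro h
  by_cases hi : IsSquare (-1 : K)
  · rcases h.isSquare_of_isSquare_neg_one h2 hi with h | h | h | h
    · exact ha h
    · exact hb h
    · exact hc h
    · exact hbc h.1
  · obtain ⟨L, _, _, s, w, _, -, -, -, hw, -, hsq⟩ := exists_quadratic_extension h2 hi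
    have h2' : (2 : L) ≠ 0 := by
      rw [← map_ofNat (algebraMap K L) 2]
      exact (map_ne_zero _).2 h2
    have hsq' : ∀ t : K, ¬ IsSquare t → ¬ IsSquare (-t) → ¬ IsSquare (algebraMap K L t) := by
      intro t ht ht' h
      rcases hsq t h with h | h
      · exact ht h
      · exact ht' (by rwa [neg_one_mul] at h)
    have hi' : IsSquare (-1 : L) := ⟨w, by rw [← sq, hw]; simp⟩
    rcases h.isSquare_of_isSquare_neg_one h2' hi' with h' | h' | h' | ⟨h', h''⟩
    · exact hsq' _ ha ha' h'
    · exact hsq' _ hb hb' h'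
    · exact hsq' _ hc hc' h'
    · have hbc' : IsSquare (-(b * c) : K) := by
        by_contra hn
        exact hsq' _ hbc hn h'
      have hac' : IsSquare (a * c : K) := by
        by_contra hn
        exact hsq' _ hac (by rwa [neg_neg]) h''
      have hab : IsSquare (-(a * b) : K) := by
        obtain ⟨r, hr⟩ := hbc'
        obtain ⟨t, ht⟩ := hac'
        refine ⟨r * t / c, ?_⟩
        field_simp
        linear_combination (a * c : K) * hr + r ^ 2 * ht
      rcases h.isSquare_of_isSquare_neg_mul h2 hab hac' with h | h | h | h
      · exact hi h
      · exact hb h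
      · exact hc h
      · exact hbc h

end negative

lemma reducesTo_problemR_neg_neg_one' (h2 : (2 : K) ≠ 0) (a b c : Kˣ) :
    ReducesTo (noether3311 (-1) (-1) 1 a b c) (problemR a b c) :=
  (reducesTo_problemR_neg_neg_one h2 a b c).trans (problemR_swap₁₃ h2 c b a)

lemma reducesTo_problemR_neg_one_neg (h2 : (2 : K) ≠ 0) (a b c : Kˣ) :
    ReducesTo (noether3311 (-1) 1 (-1) a b c) (problemR (-a) b c) :=
  ((reducesTo_swap₂₃ (a' := -a) (by simp)).trans
    (reducesTo_problemR_neg_neg_one' h2 (-a) c b)).trans (problemR_swap₂₃ h2 (-a) c b)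

lemma reducesTo_problemR_one_neg_neg (h2 : (2 : K) ≠ 0) (a b c : Kˣ) :
    ReducesTo (noether3311 1 (-1) (-1) a b c) (problemR a (-b) (-c)) :=
  ((reducesTo_swap₁₂ (c' := -c) (by simp)).trans
    (reducesTo_problemR_neg_one_neg h2 b a (-c))).trans (problemR_swap₁₂ h2 (-b) a (-c))

lemma affirmative_one_neg_one (h2 : (2 : K) ≠ 0) (a b c : Kˣ) :
    Affirmative (noether3311 1 (-1) 1 a b c) :=
  (reducesTo_swap₂₃ (a' := a) (by simp)).affirmative_iff.2 (affirmative_one_one_neg h2 a c b)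

lemma affirmative_neg_one_one (h2 : (2 : K) ≠ 0) (a b c : Kˣ) :
    Affirmative (noether3311 (-1) 1 1 a b c) :=
  (reducesTo_swap₁₂ (c' := c) (by simp)).affirmative_iff.2 (affirmative_one_neg_one h2 b a c)

lemma reducesTo_problemR_neg_of_isSquare₂ (h2 : (2 : K) ≠ 0) {a b c : Kˣ}
    (h : IsSquare b ∨ IsSquare (-b)) :
    ReducesTo (noether3311 (-1) (-1) (-1) a b c) (problemR a (-1) (-c)) :=
  (reducesTo_neg_swap₁₂ a b c).trans (reducesTo_problemR_neg_of_isSquare h2 h)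

lemma reducesTo_problemR_neg_of_isSquare_neg_mul (h2 : (2 : K) ≠ 0) {a b c : Kˣ}
    (h : IsSquare (-(a * c))) :
    ReducesTo (noether3311 (-1) (-1) (-1) a b c) (problemR (-a) b (a * b)) := by
  have := (reducesTo_neg_swap₂₃ a b c).trans
    (reducesTo_problemR_neg_of_isSquare_mul h2 (by rwa [neg_mul]))
  rwa [neg_mul, neg_neg] at this

lemma reducesTo_problemR_neg_of_isSquare_mul₂₃ (h2 : (2 : K) ≠ 0) {a b c : Kˣ}
    (h : IsSquare (b * c)) :
    ReducesTo (noether3311 (-1) (-1) (-1) a b c) (problemR (-b) a (a * b)) := by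
  have := (reducesTo_neg_swap₁₂ a b c).trans
    (reducesTo_problemR_neg_of_isSquare_neg_mul h2 (by rwa [mul_neg, neg_neg]))
  rwa [mul_comm b a] at this

end MonomialNoether
end

theorem mainTheorem2 {K : Type*} [Field K] (hK : ringChar K ≠ 2) (a b c : Kˣ) :
    -- (1) all signs equal to `1`
    MonomialNoether.ReducesTo (MonomialNoether.noether3311 1 1 1 a b c)
      (MonomialNoether.problemR a b c) ∧
    -- (2) exactly two signs equal to `-1`
    (MonomialNoether.ReducesTo (MonomialNoether.noether3311 (-1) (-1) 1 a b c)
      (MonomialNoether.problemR a b c) ∧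
    MonomialNoether.ReducesTo (MonomialNoether.noether3311 (-1) 1 (-1) a b c)
      (MonomialNoether.problemR (-a) b c) ∧
    MonomialNoether.ReducesTo (MonomialNoether.noether3311 1 (-1) (-1) a b c)
      (MonomialNoether.problemR a (-b) (-c))) ∧
    -- (3) exactly one sign equal to `-1`
    (MonomialNoether.Affirmative (MonomialNoether.noether3311 1 1 (-1) a b c) ∧
    MonomialNoether.Affirmative (MonomialNoether.noether3311 1 (-1) 1 a b c) ∧
    MonomialNoether.Affirmative (MonomialNoether.noether3311 (-1) 1 1 a b c)) ∧
    -- (4) all signs equal to `-1`; `IsSquare` is meant in the group `Kˣ`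
    (((IsSquare a ∨ IsSquare (-a)) →
      MonomialNoether.ReducesTo (MonomialNoether.noether3311 (-1) (-1) (-1) a b c)
        (MonomialNoether.problemR b (-1) c)) ∧
    ((IsSquare b ∨ IsSquare (-b)) →
      MonomialNoether.ReducesTo (MonomialNoether.noether3311 (-1) (-1) (-1) a b c)
        (MonomialNoether.problemR a (-1) (-c))) ∧
    ((IsSquare c ∨ IsSquare (-c)) →
      MonomialNoether.ReducesTo (MonomialNoether.noether3311 (-1) (-1) (-1) a b c)
        (MonomialNoether.problemR a (-1) b)) ∧
    (IsSquare (a * b) →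
      MonomialNoether.ReducesTo (MonomialNoether.noether3311 (-1) (-1) (-1) a b c)
        (MonomialNoether.problemR a c (-(a * c)))) ∧
    (IsSquare (-(a * c)) →
      MonomialNoether.ReducesTo (MonomialNoether.noether3311 (-1) (-1) (-1) a b c)
        (MonomialNoether.problemR (-a) b (a * b))) ∧
    (IsSquare (b * c) →
      MonomialNoether.ReducesTo (MonomialNoether.noether3311 (-1) (-1) (-1) a b c)
        (MonomialNoether.problemR (-b) a (a * b))) ∧
    ((¬ IsSquare a ∧ ¬ IsSquare (-a) ∧ ¬ IsSquare b ∧ ¬ IsSquare (-b) ∧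
        ¬ IsSquare c ∧ ¬ IsSquare (-c) ∧
        ¬ IsSquare (a * b) ∧ ¬ IsSquare (-(a * c)) ∧ ¬ IsSquare (b * c)) →
      ¬ MonomialNoether.Affirmative
        (MonomialNoether.noether3311 (-1) (-1) (-1) a b c))) := by
  have h2 : (2 : K) ≠ 0 := Ring.two_ne_zero hK
  refine ⟨MonomialNoether.reducesTo_problemR_one_one_one h2 a b c,
    ⟨MonomialNoether.reducesTo_problemR_neg_neg_one' h2 a b c,
      MonomialNoether.reducesTo_problemR_neg_one_neg h2 a b c,
      MonomialNoether.reducesTo_problemR_one_neg_neg h2 a b c⟩,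
    ⟨MonomialNoether.affirmative_one_one_neg h2 a b c,
      MonomialNoether.affirmative_one_neg_one h2 a b c,
      MonomialNoether.affirmative_neg_one_one h2 a b c⟩,
    fun h => MonomialNoether.reducesTo_problemR_neg_of_isSquare h2 h,
    fun h => MonomialNoether.reducesTo_problemR_neg_of_isSquare₂ h2 h,
    fun h => MonomialNoether.reducesTo_problemR_neg_of_isSquare₃ h2 h,
    fun h => MonomialNoether.reducesTo_problemR_neg_of_isSquare_mul h2 h,
    fun h => MonomialNoether.reducesTo_problemR_neg_of_isSquare_neg_mul h2 h,
    fun h => MonomialNoether.reducesTo_problemR_neg_of_isSquare_mul₂₃ h2 h, ?_⟩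
  rintro ⟨ha, ha', hb, hb', hc, hc', -, hac, hbc⟩
  exact MonomialNoether.not_affirmative_of_not_isSquare h2
    (fun h => ha (MonomialNoether.isSquare_units h))
    (fun h => ha' (MonomialNoether.isSquare_units (by simpa using h)))
    (fun h => hb (MonomialNoether.isSquare_units h))
    (fun h => hb' (MonomialNoether.isSquare_units (by simpa using h)))
    (fun h => hc (MonomialNoether.isSquare_units h))
    (fun h => hc' (MonomialNoether.isSquare_units (by simpa using h)))
    (fun h => hac (MonomialNoether.isSquare_units (by simpa using h)))
    (fun h => hbc (MonomialNoether.isSquare_units (by simpa using h)))
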